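/- Let $I$ be a finite or countably infinite alphabet with the discrete topology, $A\colon I\times I\to\{0,1\}$ an incidence matrix, $E^\infty=\{\omega\in I^{\mathbb N}: A_{\omega_j\omega_{j+1}}=1 \text{ for all } j\ge 1\}$ with the topology induced by the product topology, and $\sigma$ the shift map on $E^\infty$. Let $E^n$ be the set of words of length $n$ that occur as a subword of an element of $E^\infty$, let $E^*=\bigcup_{n\ge 0}E^n$ (where $E^0$ contains only the empty word), and let $[\omega]\subset E^\infty$ be the cylinder set of sequences that begin with $\omega\in E^*$. Assume that $A$ is finitely irreducible: there is a finite set $\Lambda\subset E^*$ such that for all $i,j\in I$ there is $\omega\in\Lambda$ with $i\omega j\in E^*$. Fix $\theta\in(0,1)$. For a continuous function $f$ on $E^\infty$ put $\mathrm{var}_n(f)=\sup\{|f(x)-f(y)| : x_i=y_i \text{ for } i\le n\}$ and $\|f\|_\theta=\sup_{n\ge1}\theta^{-n}\,\mathrm{var}_n(f)$. Call $f$ $\theta$-Hölder if $\|f\|_\theta<\infty$, and let $\mathcal F^b_\theta(E^\infty)$ be the space of bounded complex-valued $\theta$-Hölder functions with the norm $\|\cdot\|_\theta+\|\cdot\|_\infty$.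 Let $f=u+\mathbf i v\colon E^\infty\to\mathbb C$ be $\theta$-Hölder (not necessarily bounded), with $u,v$ real-valued and $u$ summable, i.e. $\sum_{e\in I}\exp(\sup_{[e]}u)<\infty$. Let $\mathcal L_f$ be the Perron–Frobenius operator on $\mathcal F_\theta^b(E^\infty)$, $$\mathcal L_f(g)(\omega)=\sum_{e\in I:\,A_{e\omega_1}=1}\mathrm e^{f(e\omega)}g(e\omega),$$ which is a bounded linear operator. With $S_nu=\sum_{j=0}^{n-1}u\circ\sigma^j$, let $$P(u)=\lim_{n\to\infty}\frac1n\log\sum_{\omega\in E^n}\exp\Big(\sup_{\tau\in[\omega]}S_nu(\tau)\Big)$$ be the topological pressure. For $a\in[0,2\pi)$, $f$ is called an $a$-function if there is a continuous $\zeta\colon E^\infty\to\mathbb R$ such that $v-a+\zeta\circ\sigma-\zeta$ takes values only in $2\pi\mathbb Z$; $f$ is called regular if it is not an $a$-function for any $a\in[0,2\pi)$. If $f$ is regular, then the limit $P(u)$ exists and is a real number, and there is $r$ with $0\le r<\exp(P(u))$ such that the spectrum of $\mathcal L_f$ on $\mathcal F_\theta^b(E^\infty)$ is contained in the closed disc $\{z\in\mathbb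 C:|z|\le r\}$. -/

import Mathlib

open Filter Topology
open scoped ENNReal BoundedContinuousFunction

noncomputable section

namespace MarkovShift

variable {ι : Type*}

/-- The space of admissible infinite sequences over the alphabet `ι`. The incidence matrix with
entries `0`, `1` is given as the relation `A`, where `A i j` says that the `(i, j)` entry is `1`. -/
abbrev Shift (A : ι → ι → Prop) : Type _ :=
  {x : ℕ → ι // ∀ n, A (x n) (x (n + 1))}

variable {A : ι → ι → Prop}

/-- The shift map. -/
def shift (x : Shift A) : Shift A :=
  ⟨fun n => x.1 (n + 1), fun n => x.2 (n + 1)⟩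

/-- The sequence `e ω`, for a letter `e` that may precede `ω`. -/
def cons (e : ι) (ω : Shift A) (h : A e (ω.1 0)) : Shift A :=
  ⟨fun n => Nat.casesOn n e ω.1, fun n => by cases n with
    | zero => exact h
    | succ k => exact ω.2 k⟩

/-- The cylinder set of a finite word. -/
def cylinder (A : ι → ι → Prop) (w : List ι) : Set (Shift A) :=
  {x | ∀ k : Fin w.length, x.1 k = w.get k}

/-- The words of length `n` that occur as a subword of an admissible infinite sequence. -/
def words (A : ι → ι → Prop) (n : ℕ) : Set (List ι) :=
  {w | w.length = n ∧ ∃ (x : Shift A) (m : ℕ), shift^[m] x ∈ cylinder A w}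

/-- All finite admissible words. -/
def finiteWords (A : ι → ι → Prop) : Set (List ι) :=
  ⋃ n, words A n

/-- There is a finite set `Λ` of admissible words such that any two letters `i`, `j` can be
connected by some `w` in `Λ`, that is, `i w j` is admissible. -/
def FinitelyIrreducible (A : ι → ι → Prop) : Prop :=
  ∃ Λ : Set (List ι), Λ.Finite ∧ Λ ⊆ finiteWords A ∧
    ∀ i j : ι, ∃ w ∈ Λ, i :: (w ++ [j]) ∈ finiteWords A

/-- The partition function `∑_{w ∈ Eⁿ} exp (sup_{[w]} S_n u)`, with values in `[0, ∞]`. -/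
def partitionFunction (u : Shift A → ℝ) (n : ℕ) : ℝ≥0∞ :=
  ∑' w : words A n, EReal.exp (⨆ x ∈ cylinder A w.1, ((birkhoffSum shift u n x : ℝ) : EReal))

/-- The real number `P` is the topological pressure of `u`: the limit defining the pressure
exists (in the extended reals) and is equal to `P`. -/
def HasPressure (u : Shift A → ℝ) (P : ℝ) : Prop :=
  Tendsto (fun n : ℕ => ENNReal.log (partitionFunction u n) / (n : EReal)) atTop (𝓝 (P : EReal))

/-- Summability of `u`: `∑_e exp (sup_{[e]} u)` is finite. -/
def IsSummable (u : Shift A → ℝ) : Prop :=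
  ∑' e : ι, EReal.exp (⨆ x ∈ cylinder A [e], ((u x : ℝ) : EReal)) < ⊤

/-- The number `exp (sup_{[e]} u)`, for `u` summable. -/
def weight (u : Shift A → ℝ) (e : ι) : ℝ :=
  (EReal.exp (⨆ x ∈ cylinder A [e], ((u x : ℝ) : EReal))).toReal

theorem weight_nonneg (u : Shift A → ℝ) (e : ι) : 0 ≤ weight u e := ENNReal.toReal_nonneg

theorem summable_weight {u : Shift A → ℝ} (hu : IsSummable u) : Summable (weight u) :=
  ENNReal.summable_toReal (ne_of_lt hu)

theorem exp_le_weight {u : Shift A → ℝ} (hu : IsSummable u) (e : ι) (ω : Shift A)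
    (h : A e (ω.1 0)) : Real.exp (u (cons e ω h)) ≤ weight u e := by
  have hne : EReal.exp (⨆ x ∈ cylinder A [e], ((u x : ℝ) : EReal)) ≠ ⊤ :=
    ENNReal.ne_top_of_tsum_ne_top (ne_of_lt hu) e
  have hmem : cons e ω h ∈ cylinder A [e] := by
    intro k
    have hk : k = ⟨0, by simp⟩ := Fin.ext (Nat.lt_one_iff.1 k.2)
    subst hk
    rfl
  have hle : EReal.exp ((u (cons e ω h) : ℝ) : EReal) ≤
      EReal.exp (⨆ x ∈ cylinder A [e], ((u x : ℝ) : EReal)) :=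
    EReal.exp_monotone (le_iSup₂ (f := fun x (_ : x ∈ cylinder A [e]) => ((u x : ℝ) : EReal))
      (cons e ω h) hmem)
  have := ENNReal.toReal_mono hne hle
  rwa [EReal.exp_coe, ENNReal.toReal_ofReal (Real.exp_pos _).le] at this

theorem norm_exp_sub_exp_le {a b : ℂ} {c : ℝ} (ha : Real.exp a.re ≤ c) (hb : Real.exp b.re ≤ c) :
    ‖Complex.exp a - Complex.exp b‖ ≤ c * ‖a - b‖ := by
  have hc : 0 < c := (Real.exp_pos _).trans_le ha
  have key := Convex.norm_image_sub_le_of_norm_deriv_le (𝕜 := ℂ) (f := Complex.exp)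
    (s := {z : ℂ | z.re ≤ Real.log c}) (C := c) (x := b) (y := a)
    (fun x _ => Complex.differentiableAt_exp)
    (fun x hx => by
      rw [Complex.deriv_exp, Complex.norm_exp]
      exact (Real.exp_le_exp.2 hx).trans (Real.exp_log hc).le)
    (convex_halfSpace_re_le _) ((Real.le_log_iff_exp_le hc).2 hb)
    ((Real.le_log_iff_exp_le hc).2 ha)
  exact key

theorem tsum_weight_nonneg (u : Shift A → ℝ) : 0 ≤ ∑' e, weight u e :=
  tsum_nonneg (weight_nonneg u)

theorem norm_tsum_le_weight {u : Shift A → ℝ} (hu : IsSummable u) (s : Set ι) {t : s → ℂ} {C : ℝ}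
    (hC : 0 ≤ C) (ht : ∀ e, ‖t e‖ ≤ weight u e * C) : ‖∑' e, t e‖ ≤ (∑' e, weight u e) * C := by
  have hs : Summable fun e : s => weight u e * C := ((summable_weight hu).subtype s).mul_right C
  calc ‖∑' e, t e‖ ≤ ∑' e : s, weight u e * C := tsum_of_norm_bounded hs.hasSum ht
    _ = (∑' e : s, weight u e) * C := tsum_mul_right
    _ ≤ _ := mul_le_mul_of_nonneg_right
        (Summable.tsum_subtype_le (weight u) s (weight_nonneg u) (summable_weight hu)) hC

section Holder

variable {F : Type*} [NormedAddCommGroup F]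

/-- The `n`-th variation, with values in `[0, ∞]`. -/
def variation (n : ℕ) (f : Shift A → F) : ℝ≥0∞ :=
  ⨆ (x : Shift A) (y : Shift A) (_ : ∀ i < n, x.1 i = y.1 i), ‖f x - f y‖ₑ

/-- The Hölder seminorm `sup_{n ≥ 1} var_n(f) / θ ^ n`, with values in `[0, ∞]`. -/
def holderSeminorm (θ : Set.Ioo (0 : ℝ) 1) (f : Shift A → F) : ℝ≥0∞ :=
  ⨆ (n : ℕ) (_ : 1 ≤ n), variation n f / ENNReal.ofReal θ ^ n

theorem holderSeminorm_le_iff (θ : Set.Ioo (0 : ℝ) 1) (f : Shift A → F) {K : ℝ} (hK : 0 ≤ K) :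
    holderSeminorm θ f ≤ ENNReal.ofReal K ↔
      ∀ n, 1 ≤ n → ∀ x y : Shift A, (∀ i < n, x.1 i = y.1 i) →
        ‖f x - f y‖ ≤ K * (θ : ℝ) ^ n := by
  have hθ : 0 < (θ : ℝ) := θ.2.1
  simp only [holderSeminorm, variation, iSup_le_iff]
  refine forall₂_congr fun n _ => ?_
  rw [ENNReal.div_le_iff (by simpa using fun h => absurd h (not_le.2 hθ)) (by finiteness),
    ← ENNReal.ofReal_pow hθ.le, ← ENNReal.ofReal_mul hK]
  simp only [iSup_le_iff]
  refine forall₃_congr fun x y _ => ?_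
  rw [← ofReal_norm, ENNReal.ofReal_le_ofReal_iff (by positivity)]

theorem norm_sub_le_of_holder {θ : Set.Ioo (0 : ℝ) 1} {f : Shift A → F}
    (h : holderSeminorm θ f < ⊤) {n : ℕ} (hn : 1 ≤ n) {x y : Shift A}
    (hxy : ∀ i < n, x.1 i = y.1 i) :
    ‖f x - f y‖ ≤ (holderSeminorm θ f).toReal * (θ : ℝ) ^ n :=
  (holderSeminorm_le_iff θ f ENNReal.toReal_nonneg).1
    (ENNReal.ofReal_toReal h.ne).ge n hn x y hxy

theorem holderSeminorm_toReal_le {θ : Set.Ioo (0 : ℝ) 1} {f : Shift A → F} {K : ℝ} (hK : 0 ≤ K)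
    (h : ∀ n, 1 ≤ n → ∀ x y : Shift A, (∀ i < n, x.1 i = y.1 i) →
      ‖f x - f y‖ ≤ K * (θ : ℝ) ^ n) :
    holderSeminorm θ f < ⊤ ∧ (holderSeminorm θ f).toReal ≤ K := by
  have := (holderSeminorm_le_iff θ f hK).2 h
  exact ⟨this.trans_lt ENNReal.ofReal_lt_top, ENNReal.toReal_le_of_le_ofReal hK this⟩

variable [TopologicalSpace ι]

/-- `θ`-Hölder continuous functions (not necessarily bounded). -/
def IsHolder (θ : Set.Ioo (0 : ℝ) 1) (f : Shift A → F) : Prop :=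
  Continuous f ∧ holderSeminorm θ f < ⊤

end Holder

variable [TopologicalSpace ι]

/-- The bounded complex-valued `θ`-Hölder functions as a subspace of the bounded continuous
functions. -/
def holderSubmodule (A : ι → ι → Prop) (θ : Set.Ioo (0 : ℝ) 1) : Submodule ℂ (Shift A →ᵇ ℂ) where
  carrier := {g | holderSeminorm θ (g : Shift A → ℂ) < ⊤}
  zero_mem' := (holderSeminorm_toReal_le le_rfl (by simp)).1
  add_mem' := by
    intro f g hf hg
    refine (holderSeminorm_toReal_le
      (add_nonneg (ENNReal.toReal_nonneg (a := holderSeminorm θ f))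
        (ENNReal.toReal_nonneg (a := holderSeminorm θ g))) ?_).1
    intro n hn x y hxy
    have h1 := norm_sub_le_of_holder hf hn hxy
    have h2 := norm_sub_le_of_holder hg hn hxy
    calc ‖(f + g) x - (f + g) y‖ = ‖(f x - f y) + (g x - g y)‖ := by
          congr 1; simp only [BoundedContinuousFunction.coe_add, Pi.add_apply]; ring
      _ ≤ _ := (norm_add_le _ _).trans (by linarith)
  smul_mem' := by
    intro c f hf
    refine (holderSeminorm_toReal_le
      (mul_nonneg (norm_nonneg c) (ENNReal.toReal_nonneg (a := holderSeminorm θ f))) ?_).1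
    intro n hn x y hxy
    have h1 := norm_sub_le_of_holder hf hn hxy
    simp only [BoundedContinuousFunction.coe_smul, ← smul_sub, norm_smul]
    calc _ ≤ ‖c‖ * _ := mul_le_mul_of_nonneg_left h1 (norm_nonneg c)
      _ = _ := by ring

/-- The space of bounded complex-valued `θ`-Hölder functions, which carries the norm
`‖g‖_θ + ‖g‖_∞` (and not the supremum norm). -/
def HolderSpace (A : ι → ι → Prop) (θ : Set.Ioo (0 : ℝ) 1) : Type _ :=
  holderSubmodule A θ

namespace HolderSpace

variable {θ : Set.Ioo (0 : ℝ) 1}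

instance : AddCommGroup (HolderSpace A θ) := inferInstanceAs (AddCommGroup (holderSubmodule A θ))

instance : Module ℂ (HolderSpace A θ) := inferInstanceAs (Module ℂ (holderSubmodule A θ))

/-- The underlying bounded continuous function. -/
def toBCF (g : HolderSpace A θ) : Shift A →ᵇ ℂ := Subtype.val g

instance : CoeFun (HolderSpace A θ) (fun _ => Shift A → ℂ) := ⟨fun g => g.toBCF⟩

theorem holder (g : HolderSpace A θ) : holderSeminorm θ (g : Shift A → ℂ) < ⊤ := Subtype.prop g

theorem toBCF_add (f g : HolderSpace A θ) : (f + g).toBCF = f.toBCF + g.toBCF := rfl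

theorem toBCF_neg (g : HolderSpace A θ) : (-g).toBCF = -g.toBCF := rfl

theorem toBCF_zero : (0 : HolderSpace A θ).toBCF = 0 := rfl

theorem toBCF_smul (c : ℂ) (g : HolderSpace A θ) : (c • g).toBCF = c • g.toBCF := rfl

theorem toBCF_injective : Function.Injective (toBCF : HolderSpace A θ → (Shift A →ᵇ ℂ)) :=
  Subtype.val_injective

/-- The norm `‖g‖_θ + ‖g‖_∞`. -/
def normFun (g : HolderSpace A θ) : ℝ :=
  (holderSeminorm θ (g : Shift A → ℂ)).toReal + ‖g.toBCF‖

theorem seminorm_smul_le (c : ℂ) (g : HolderSpace A θ) :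
    (holderSeminorm θ ((c • g : HolderSpace A θ) : Shift A → ℂ)).toReal ≤
      ‖c‖ * (holderSeminorm θ (g : Shift A → ℂ)).toReal := by
  refine (holderSeminorm_toReal_le (mul_nonneg (norm_nonneg c) ENNReal.toReal_nonneg) ?_).2
  intro n hn x y hxy
  have h1 := norm_sub_le_of_holder g.holder hn hxy
  simp only [toBCF_smul, BoundedContinuousFunction.coe_smul, ← smul_sub, norm_smul]
  calc _ ≤ ‖c‖ * _ := mul_le_mul_of_nonneg_left h1 (norm_nonneg c)
    _ = _ := by ring

theorem seminorm_add_le (f g : HolderSpace A θ) :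
    (holderSeminorm θ ((f + g : HolderSpace A θ) : Shift A → ℂ)).toReal ≤
      (holderSeminorm θ (f : Shift A → ℂ)).toReal +
        (holderSeminorm θ (g : Shift A → ℂ)).toReal := by
  refine (holderSeminorm_toReal_le (add_nonneg ENNReal.toReal_nonneg ENNReal.toReal_nonneg) ?_).2
  intro n hn x y hxy
  have h1 := norm_sub_le_of_holder f.holder hn hxy
  have h2 := norm_sub_le_of_holder g.holder hn hxy
  calc ‖(f + g).toBCF x - (f + g).toBCF y‖ = ‖(f x - f y) + (g x - g y)‖ := by
        congr 1; simp only [toBCF_add, BoundedContinuousFunction.coe_add, Pi.add_apply]; ring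
    _ ≤ _ := (norm_add_le _ _).trans (by linarith)

theorem normFun_smul_le (c : ℂ) (g : HolderSpace A θ) : normFun (c • g) ≤ ‖c‖ * normFun g := by
  have h := seminorm_smul_le c g
  have h2 : ‖(c • g).toBCF‖ = ‖c‖ * ‖g.toBCF‖ := by rw [toBCF_smul, norm_smul]
  unfold normFun
  rw [h2, mul_add]
  linarith

theorem normFun_neg_le (g : HolderSpace A θ) : normFun (-g) ≤ normFun g := by
  have h := normFun_smul_le (-1) g
  simpa using h

instance : NormedAddCommGroup (HolderSpace A θ) :=
  AddGroupNorm.toNormedAddCommGroup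
    { toFun := normFun
      map_zero' := by
        have h := normFun_smul_le 0 (0 : HolderSpace A θ)
        have h0 : 0 ≤ normFun (0 : HolderSpace A θ) :=
          add_nonneg ENNReal.toReal_nonneg (norm_nonneg _)
        simp only [smul_zero, norm_zero, zero_mul] at h
        exact le_antisymm h h0
      add_le' := by
        intro f g
        have h1 := seminorm_add_le f g
        have h2 : ‖(f + g).toBCF‖ ≤ ‖f.toBCF‖ + ‖g.toBCF‖ := norm_add_le f.toBCF g.toBCF
        unfold normFun
        linarith
      neg' := by
        intro g
        refine le_antisymm (normFun_neg_le g) ?_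
        simpa using normFun_neg_le (-g)
      eq_zero_of_map_eq_zero' := by
        intro g hg
        have h1 : 0 ≤ (holderSeminorm θ (g : Shift A → ℂ)).toReal := ENNReal.toReal_nonneg
        have h2 : ‖g.toBCF‖ = 0 := by
          refine le_antisymm ?_ (norm_nonneg _)
          have : normFun g = 0 := hg
          unfold normFun at this
          linarith
        exact toBCF_injective (by rw [norm_eq_zero.1 h2, toBCF_zero]) }

theorem norm_def (g : HolderSpace A θ) :
    ‖g‖ = (holderSeminorm θ (g : Shift A → ℂ)).toReal + ‖g.toBCF‖ := rfl

instance : NormedSpace ℂ (HolderSpace A θ) where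
  norm_smul_le c g := normFun_smul_le c g

end HolderSpace

/-- The Perron-Frobenius operator on functions:
`(L_f g)(ω) = ∑_{e : A e ω₁} exp (f (e ω)) g (e ω)`. -/
def transfer (f g : Shift A → ℂ) (ω : Shift A) : ℂ :=
  ∑' e : {e : ι // A e (ω.1 0)}, Complex.exp (f (cons e.1 ω e.2)) * g (cons e.1 ω e.2)

section Operator

variable {θ : Set.Ioo (0 : ℝ) 1} {f : Shift A → ℂ}

theorem norm_term_le (hu : IsSummable fun x => (f x).re) (g : Shift A →ᵇ ℂ) (ω : Shift A)
    (e : {e : ι // A e (ω.1 0)}) :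
    ‖Complex.exp (f (cons e.1 ω e.2)) * g (cons e.1 ω e.2)‖ ≤
      weight (fun x => (f x).re) e.1 * ‖g‖ := by
  rw [norm_mul, Complex.norm_exp]
  exact mul_le_mul (exp_le_weight hu e.1 ω e.2) (g.norm_coe_le_norm _) (norm_nonneg _)
    (weight_nonneg _ _)

theorem summable_term (hu : IsSummable fun x => (f x).re) (g : Shift A →ᵇ ℂ) (ω : Shift A) :
    Summable fun e : {e : ι // A e (ω.1 0)} =>
      Complex.exp (f (cons e.1 ω e.2)) * g (cons e.1 ω e.2) :=
  Summable.of_norm_bounded (((summable_weight hu).subtype _).mul_right _) (norm_term_le hu g ω)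

theorem norm_transfer_le (hu : IsSummable fun x => (f x).re) (g : Shift A →ᵇ ℂ) (ω : Shift A) :
    ‖transfer f g ω‖ ≤ (∑' e, weight (fun x => (f x).re) e) * ‖g‖ :=
  norm_tsum_le_weight hu {e | A e (ω.1 0)} (norm_nonneg g) (norm_term_le hu g ω)

theorem norm_transfer_sub_le (hf : holderSeminorm θ f < ⊤) (hu : IsSummable fun x => (f x).re)
    (g : HolderSpace A θ) (n : ℕ) (hn : 1 ≤ n) (x y : Shift A) (hxy : ∀ i < n, x.1 i = y.1 i) :
    ‖transfer f g x - transfer f g y‖ ≤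
      (∑' e, weight (fun x => (f x).re) e) * (((holderSeminorm θ f).toReal + 1) * ‖g‖) *
        (θ : ℝ) ^ n := by
  have hθ : 0 < (θ : ℝ) := θ.2.1
  obtain ⟨x, hx⟩ := x
  obtain ⟨y, hy⟩ := y
  have h0 : x 0 = y 0 := hxy 0 (by omega)
  have hA : ∀ e, A e (x 0) → A e (y 0) := fun e h => h0 ▸ h
  have hty : transfer f g ⟨y, hy⟩ = ∑' e : {e : ι // A e (x 0)},
      Complex.exp (f (cons e.1 ⟨y, hy⟩ (hA _ e.2))) * g (cons e.1 ⟨y, hy⟩ (hA _ e.2)) := by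
    unfold transfer
    exact ((Equiv.subtypeEquivRight fun e => by rw [h0]).tsum_eq
      (fun e : {e : ι // A e (y 0)} => Complex.exp (f (cons e.1 ⟨y, hy⟩ e.2)) *
        g (cons e.1 ⟨y, hy⟩ e.2))).symm
  have hsy : Summable fun e : {e : ι // A e (x 0)} =>
      Complex.exp (f (cons e.1 ⟨y, hy⟩ (hA _ e.2))) * g (cons e.1 ⟨y, hy⟩ (hA _ e.2)) :=
    ((Equiv.subtypeEquivRight fun e => by rw [h0]).summable_iff
      (f := fun e : {e : ι // A e (y 0)} => Complex.exp (f (cons e.1 ⟨y, hy⟩ e.2)) *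
        g (cons e.1 ⟨y, hy⟩ e.2))).2 (summable_term hu g.toBCF ⟨y, hy⟩)
  rw [hty, transfer, ← (summable_term hu g.toBCF ⟨x, hx⟩).tsum_sub hsy, mul_assoc]
  refine norm_tsum_le_weight hu {e | A e (x 0)} (by positivity) ?_
  rintro ⟨e, he⟩
  set X := cons e ⟨x, hx⟩ he with hX
  set Y := cons e ⟨y, hy⟩ (hA e he) with hY
  have hXY : ∀ i < n + 1, X.1 i = Y.1 i := by
    intro i hi
    cases i with
    | zero => rfl
    | succ k => exact hxy k (by omega)
  have hwX := exp_le_weight hu e ⟨x, hx⟩ he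
  have hwY := exp_le_weight hu e ⟨y, hy⟩ (hA e he)
  set w := weight (fun x => (f x).re) e with hw
  have hw0 : 0 ≤ w := weight_nonneg _ _
  have hpow : (θ : ℝ) ^ (n + 1) ≤ (θ : ℝ) ^ n :=
    pow_le_pow_of_le_one hθ.le θ.2.2.le (Nat.le_succ n)
  have h1 : ‖Complex.exp (f X) - Complex.exp (f Y)‖ ≤
      w * ((holderSeminorm θ f).toReal * (θ : ℝ) ^ n) :=
    (norm_exp_sub_exp_le hwX hwY).trans (mul_le_mul_of_nonneg_left
      ((norm_sub_le_of_holder hf (by omega) hXY).trans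
        (mul_le_mul_of_nonneg_left hpow ENNReal.toReal_nonneg)) hw0)
  have h2 : ‖g X - g Y‖ ≤ ‖g‖ * (θ : ℝ) ^ n := by
    refine (norm_sub_le_of_holder g.holder (by omega) hXY).trans ?_
    refine mul_le_mul ?_ hpow (by positivity) (norm_nonneg _)
    rw [HolderSpace.norm_def]
    linarith [norm_nonneg g.toBCF]
  have h3 : ‖g X‖ ≤ ‖g‖ := by
    refine (g.toBCF.norm_coe_le_norm _).trans ?_
    rw [HolderSpace.norm_def]
    linarith [ENNReal.toReal_nonneg (a := holderSeminorm θ (g : Shift A → ℂ))]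
  have h4 : ‖Complex.exp (f Y)‖ ≤ w := by rw [Complex.norm_exp]; exact hwY
  calc ‖Complex.exp (f X) * g X - Complex.exp (f Y) * g Y‖
      = ‖(Complex.exp (f X) - Complex.exp (f Y)) * g X + Complex.exp (f Y) * (g X - g Y)‖ := by
        congr 1; ring
    _ ≤ ‖Complex.exp (f X) - Complex.exp (f Y)‖ * ‖g X‖ + ‖Complex.exp (f Y)‖ * ‖g X - g Y‖ := by
        rw [← norm_mul, ← norm_mul]; exact norm_add_le _ _
    _ ≤ w * ((holderSeminorm θ f).toReal * (θ : ℝ) ^ n) * ‖g‖ + w * (‖g‖ * (θ : ℝ) ^ n) := by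
        gcongr
    _ = _ := by ring

theorem continuous_of_holder [DiscreteTopology ι] {g : Shift A → ℂ} (hg : holderSeminorm θ g < ⊤) :
    Continuous g := by
  rw [continuous_iff_continuousAt]
  intro x
  rw [ContinuousAt, Metric.tendsto_nhds]
  intro ε hε
  have hlim : Tendsto (fun n : ℕ => (holderSeminorm θ g).toReal * (θ : ℝ) ^ n) atTop (𝓝 0) := by
    simpa using (tendsto_pow_atTop_nhds_zero_of_lt_one θ.2.1.le θ.2.2).const_mul
      (holderSeminorm θ g).toReal
  obtain ⟨n, hn, hn1⟩ := ((hlim.eventually_lt_const hε).and (eventually_ge_atTop 1)).exists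
  have hev : ∀ᶠ y : Shift A in 𝓝 x, ∀ i ∈ Finset.range n, y.1 i = x.1 i := by
    rw [Filter.eventually_all_finset]
    intro i _
    have hc : Continuous fun y : Shift A => y.1 i := (continuous_apply i).comp continuous_subtype_val
    exact hc.continuousAt.eventually
      (((isOpen_discrete ({x.1 i} : Set ι)).mem_nhds rfl : ({x.1 i} : Set ι) ∈ 𝓝 (x.1 i)))
  filter_upwards [hev] with y hy
  rw [dist_eq_norm]
  exact (norm_sub_le_of_holder hg hn1 fun i hi => hy i (Finset.mem_range.2 hi)).trans_lt hn

theorem holder_transfer (hf : IsHolder θ f) (hu : IsSummable fun x => (f x).re)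
    (g : HolderSpace A θ) :
    holderSeminorm θ (transfer f g) < ⊤ ∧ (holderSeminorm θ (transfer f g)).toReal ≤
      (∑' e, weight (fun x => (f x).re) e) * (((holderSeminorm θ f).toReal + 1) * ‖g‖) :=
  holderSeminorm_toReal_le
    (mul_nonneg (tsum_weight_nonneg _) (mul_nonneg (by positivity) (norm_nonneg g)))
    (norm_transfer_sub_le hf.2 hu g)

variable [DiscreteTopology ι]

/-- The function `L_f g` as an element of the space of bounded Hölder functions. -/
def transferHolder (hf : IsHolder θ f) (hu : IsSummable fun x => (f x).re) (g : HolderSpace A θ) :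
    HolderSpace A θ :=
  ⟨BoundedContinuousFunction.ofNormedAddCommGroup (transfer f g)
    (continuous_of_holder (holder_transfer hf hu g).1) _ (norm_transfer_le hu g.toBCF),
    (holder_transfer hf hu g).1⟩

theorem transferHolder_apply (hf : IsHolder θ f) (hu : IsSummable fun x => (f x).re)
    (g : HolderSpace A θ) (ω : Shift A) : transferHolder hf hu g ω = transfer f g ω := rfl

/-- The Perron-Frobenius operator `L_f` as a bounded linear operator on the space of bounded
`θ`-Hölder functions, for a `θ`-Hölder function `f` with summable real part. -/
def perronFrobenius (hf : IsHolder θ f) (hu : IsSummable fun x => (f x).re) :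
    HolderSpace A θ →L[ℂ] HolderSpace A θ :=
  LinearMap.mkContinuous
    { toFun := transferHolder hf hu
      map_add' := by
        intro g h
        refine HolderSpace.toBCF_injective (BoundedContinuousFunction.ext fun ω => ?_)
        rw [HolderSpace.toBCF_add, BoundedContinuousFunction.add_apply, transferHolder_apply,
          transferHolder_apply, transferHolder_apply, transfer, transfer, transfer,
          ← (summable_term hu g.toBCF ω).tsum_add (summable_term hu h.toBCF ω)]
        refine tsum_congr fun e => ?_
        rw [HolderSpace.toBCF_add, BoundedContinuousFunction.add_apply, mul_add]
      map_smul' := by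
        intro c g
        refine HolderSpace.toBCF_injective (BoundedContinuousFunction.ext fun ω => ?_)
        rw [RingHom.id_apply, HolderSpace.toBCF_smul, BoundedContinuousFunction.smul_apply,
          transferHolder_apply, transferHolder_apply, transfer, transfer, smul_eq_mul,
          ← tsum_mul_left]
        refine tsum_congr fun e => ?_
        rw [HolderSpace.toBCF_smul, BoundedContinuousFunction.smul_apply, smul_eq_mul]
        ring }
    ((∑' e, weight (fun x => (f x).re) e) * ((holderSeminorm θ f).toReal + 2))
    (by
      intro g
      have hS := tsum_weight_nonneg (fun x => (f x).re)
      have h1 := (holder_transfer hf hu g).2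
      have h2 : ‖(transferHolder hf hu g).toBCF‖ ≤
          (∑' e, weight (fun x => (f x).re) e) * ‖g.toBCF‖ :=
        (BoundedContinuousFunction.norm_le (mul_nonneg hS (norm_nonneg _))).2
          (norm_transfer_le hu g.toBCF)
      have h3 : ‖g.toBCF‖ ≤ ‖g‖ := by
        rw [HolderSpace.norm_def]
        linarith [ENNReal.toReal_nonneg (a := holderSeminorm θ (g : Shift A → ℂ))]
      have h4 := mul_le_mul_of_nonneg_left h3 hS
      calc ‖transferHolder hf hu g‖ = (holderSeminorm θ (transfer f g)).toReal +
            ‖(transferHolder hf hu g).toBCF‖ := rfl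
        _ ≤ _ := by linarith)

theorem perronFrobenius_apply (hf : IsHolder θ f) (hu : IsSummable fun x => (f x).re)
    (g : HolderSpace A θ) (ω : Shift A) :
    perronFrobenius hf hu g ω = transfer f g ω := rfl

end Operator

/-- `f = u + i v` is an `a`-function: there is a continuous real function `ζ` such that
`v - a + ζ ∘ σ - ζ` takes values in `2 π ℤ` only. -/
def IsAFunction (f : Shift A → ℂ) (a : ℝ) : Prop :=
  ∃ ζ : C(Shift A, ℝ), ∀ x, ∃ k : ℤ, (f x).im - a + ζ (shift x) - ζ x = 2 * Real.pi * k

/-- `f` is regular if it is not an `a`-function for any angle `a`. -/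
def IsRegular (f : Shift A → ℂ) : Prop :=
  ∀ a ∈ Set.Ico (0 : ℝ) (2 * Real.pi), ¬ IsAFunction f a

end MarkovShift

end

/-!
The argument combines quasi-compactness of the Perron-Frobenius operator `L = L_f` with a rigidity
statement about its peripheral eigenfunctions. It uses neither an eigenmeasure nor a positive
eigenfunction of `L_u`, `u = Re f`; their role is played by bounds on sums over preimages.

*Pressure.* The `n`-th iterate of `L_u` is a sum over the preimages under `σⁿ` (`preimageSum`).
Bounded distortion (`norm_birkhoffSum_sub_le`) and finite irreducibility (`exists_connection`) show
that its value at `1` is comparable, uniformly in `n` and in the point, with the partition function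
(`exists_partitionFunction_le`). These values are therefore multiplicative up to a constant factor,
so they are comparable with `exp (n P)` for some real `P`, which is the pressure
(`exists_hasPressure`).

*Quasi-compactness.* Replacing `g` in the formula for `Lⁿ g` by its values at chosen points of the
cylinders of length `n` gives a norm convergent series of rank one operators, one for each word,
hence a compact operator even if the alphabet is infinite. The error is `O(θⁿ exp (n P))`, because
`g` varies by at most `‖g‖ θⁿ` on such a cylinder (`norm_pow_sub_compactPart_le`). By the Fredholm
alternative, a spectral value of modulus at least `exp P` yields an eigenvalue of the same modulus
(`exists_eigenvector_of_mem_spectrum`).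

*Rigidity.* Let `L g = z g` with `g ≠ 0` and `|z| ≥ exp P`. Then `exp P |g| ≤ L_u |g|`. If this
were strict at some point, it would be strict by a fixed amount on a cylinder, and since the
iterates of `exp (-P) L_u` return mass to that cylinder with positive frequency, they would make
the bounded function `|g|` grow without bound (`not_add_indicator_le_preimageSum`). So `|g|` is
invariant, hence bounded away from zero (`exists_le_of_preimageSum_eq`), and equality holds in the
triangle inequality for `L g = z g`: the phases of all the terms agree. A continuous argument of
`g` (`HolderSpace.exists_continuous_arg`) then exhibits `f` as an `a`-function, where `a` is an
argument of `z` (`exists_isAFunction_of_eigenvector`). For regular `f` the spectrum thus lies in the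
open disc of radius `exp P`, and since it is compact, in a smaller closed disc.
-/

noncomputable section

namespace MarkovShift

variable {ι : Type*} {A : ι → ι → Prop}

/-! ### Words, preimages and gluing -/

theorem shift_iterate_apply (n : ℕ) (x : Shift A) (k : ℕ) :
    (shift^[n] x).1 k = x.1 (n + k) := by
  induction n generalizing x with
  | zero => simp
  | succ n ih =>
    rw [Function.iterate_succ_apply, ih]
    exact congrArg x.1 (by omega)

/-- The sequence that follows `z` up to the index `n`, where it switches to `x`. -/
def glue (z : Shift A) (n : ℕ) (x : Shift A) (h : z.1 n = x.1 0) : Shift A :=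
  ⟨fun i => if i < n then z.1 i else x.1 (i - n), fun i => by
    rcases lt_trichotomy (i + 1) n with hi | hi | hi
    · simpa [hi, (Nat.lt_succ_self i).trans hi] using z.2 i
    · subst hi
      simpa [← h] using z.2 i
    · have h1 : ¬ i < n := by omega
      have h2 : ¬ i + 1 < n := by omega
      have h3 : i + 1 - n = i - n + 1 := by omega
      simpa [h1, h2, h3] using x.2 (i - n)⟩

theorem glue_apply_of_le (z : Shift A) (n : ℕ) (x : Shift A) (h : z.1 n = x.1 0) {i : ℕ}
    (hi : i ≤ n) : (glue z n x h).1 i = z.1 i := by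
  rcases hi.lt_or_eq with hi | rfl
  · simp [glue, hi]
  · simp [glue, h]

theorem shift_iterate_glue (z : Shift A) (n : ℕ) (x : Shift A) (h : z.1 n = x.1 0) :
    shift^[n] (glue z n x h) = x := by
  refine Subtype.ext (funext fun k => ?_)
  rw [shift_iterate_apply]
  simp [glue]

theorem eq_of_shift_iterate_eq {n : ℕ} {y y' : Shift A} (h : shift^[n] y = shift^[n] y')
    (h' : ∀ i < n, y.1 i = y'.1 i) : y = y' := by
  refine Subtype.ext (funext fun k => ?_)
  rcases lt_or_ge k n with hk | hk
  · exact h' k hk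
  · obtain ⟨k, rfl⟩ := Nat.exists_eq_add_of_le hk
    rw [← shift_iterate_apply, ← shift_iterate_apply, h]

/-- The initial word of length `n` of a sequence. -/
def wordOf (n : ℕ) (y : Shift A) : words A n :=
  ⟨List.ofFn fun i : Fin n => y.1 i, by simp, y, 0, fun k => by simp⟩

theorem wordOf_eq_wordOf_iff {n : ℕ} {x y : Shift A} :
    wordOf n x = wordOf n y ↔ ∀ i < n, x.1 i = y.1 i := by
  rw [Subtype.ext_iff]
  change List.ofFn _ = List.ofFn _ ↔ _
  rw [List.ofFn_inj, funext_iff]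
  exact ⟨fun h i hi => h ⟨i, hi⟩, fun h i => h i i.2⟩

theorem wordOf_eq_iff {n : ℕ} {x : Shift A} {w : words A n} :
    wordOf n x = w ↔ x ∈ cylinder A w.1 := by
  obtain ⟨w, rfl, hw⟩ := w
  rw [Subtype.ext_iff]
  change (List.ofFn fun i : Fin w.length => x.1 i) = w ↔ ∀ k : Fin w.length, x.1 k = w.get k
  rw [← funext_iff (f := fun k : Fin w.length => x.1 k), ← List.ofFn_inj, List.ofFn_get]

theorem mem_cylinder_wordOf {n : ℕ} {x y : Shift A} :
    x ∈ cylinder A (wordOf n y).1 ↔ ∀ i < n, x.1 i = y.1 i := by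
  rw [← wordOf_eq_iff, wordOf_eq_wordOf_iff]

theorem wordOf_surjective (n : ℕ) : Function.Surjective (wordOf n : Shift A → words A n) := by
  rintro ⟨w, hw, x, m, hx⟩
  exact ⟨shift^[m] x, wordOf_eq_iff.2 hx⟩

/-- A point in the cylinder of a given word. -/
def basePoint {n : ℕ} (w : words A n) : Shift A := Function.surjInv (wordOf_surjective n) w

theorem wordOf_basePoint {n : ℕ} (w : words A n) : wordOf n (basePoint w) = w :=
  Function.surjInv_eq _ w

theorem basePoint_wordOf_apply {n : ℕ} (y : Shift A) {i : ℕ} (hi : i < n) :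
    (basePoint (wordOf n y)).1 i = y.1 i :=
  wordOf_eq_wordOf_iff.1 (wordOf_basePoint (wordOf n y)) i hi

/-! ### Bounded distortion -/

section Distortion

variable {F : Type*} [NormedAddCommGroup F] {θ : Set.Ioo (0 : ℝ) 1} {f : Shift A → F}

/-- The constant in the bounded distortion estimate for Birkhoff sums. -/
def distortion (θ : Set.Ioo (0 : ℝ) 1) (f : Shift A → F) : ℝ :=
  (holderSeminorm θ f).toReal * (1 - (θ : ℝ))⁻¹

theorem distortion_nonneg (θ : Set.Ioo (0 : ℝ) 1) (f : Shift A → F) : 0 ≤ distortion θ f :=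
  mul_nonneg ENNReal.toReal_nonneg (inv_nonneg.2 (sub_nonneg.2 θ.2.2.le))

theorem norm_birkhoffSum_sub_le (hf : holderSeminorm θ f < ⊤) (n m : ℕ) {x y : Shift A}
    (hxy : ∀ i < n + m, x.1 i = y.1 i) :
    ‖birkhoffSum shift f n x - birkhoffSum shift f n y‖ ≤ distortion θ f * (θ : ℝ) ^ m := by
  have hθ : 0 < (θ : ℝ) := θ.2.1
  have h1 : ∀ j ∈ Finset.range n, ‖f (shift^[j] x) - f (shift^[j] y)‖ ≤
      (holderSeminorm θ f).toReal * (θ : ℝ) ^ m * (θ : ℝ) ^ (n - 1 - j) := by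
    intro j hj
    have hj := Finset.mem_range.1 hj
    refine (norm_sub_le_of_holder hf (n := n + m - j) (by omega) fun i hi => ?_).trans ?_
    · rw [shift_iterate_apply, shift_iterate_apply]
      exact hxy _ (by omega)
    · rw [mul_assoc, ← pow_add]
      exact mul_le_mul_of_nonneg_left
        (pow_le_pow_of_le_one hθ.le θ.2.2.le (by omega)) ENNReal.toReal_nonneg
  calc ‖birkhoffSum shift f n x - birkhoffSum shift f n y‖
      ≤ ∑ j ∈ Finset.range n, ‖f (shift^[j] x) - f (shift^[j] y)‖ := by
        rw [birkhoffSum, birkhoffSum, ← Finset.sum_sub_distrib]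
        exact norm_sum_le _ _
    _ ≤ ∑ j ∈ Finset.range n,
        (holderSeminorm θ f).toReal * (θ : ℝ) ^ m * (θ : ℝ) ^ (n - 1 - j) :=
        Finset.sum_le_sum h1
    _ = (holderSeminorm θ f).toReal * (θ : ℝ) ^ m * ∑ j ∈ Finset.range n, (θ : ℝ) ^ j := by
        rw [← Finset.mul_sum, Finset.sum_range_reflect (fun j => (θ : ℝ) ^ j)]
    _ ≤ (holderSeminorm θ f).toReal * (θ : ℝ) ^ m * (1 - (θ : ℝ))⁻¹ := by
        gcongr
        rw [← tsum_geometric_of_lt_one hθ.le θ.2.2]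
        exact (summable_geometric_of_lt_one hθ.le θ.2.2).sum_le_tsum _ fun i _ => by positivity
    _ = _ := by rw [distortion]; ring

end Distortion

theorem birkhoffSum_le_add_distortion {θ : Set.Ioo (0 : ℝ) 1} {u : Shift A → ℝ}
    (hu : holderSeminorm θ u < ⊤) (n : ℕ) {x y : Shift A} (hxy : ∀ i < n, x.1 i = y.1 i) :
    birkhoffSum shift u n x ≤ birkhoffSum shift u n y + distortion θ u := by
  have := norm_birkhoffSum_sub_le hu n 0 hxy
  rw [pow_zero, mul_one, Real.norm_eq_abs] at this
  linarith [le_abs_self (birkhoffSum shift u n x - birkhoffSum shift u n y)]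

/-! ### Weighted sums over preimages -/

/-- The `n`-th iterate of the Perron-Frobenius operator of the real function `u`, on functions with
values in `[0, ∞]`: the sum of `exp (S_n u y) φ y` over all `y` with `σⁿ y = x`. -/
def preimageSum (u : Shift A → ℝ) (n : ℕ) (φ : Shift A → ℝ≥0∞) (x : Shift A) : ℝ≥0∞ :=
  ∑' y : {y : Shift A // shift^[n] y = x},
    ENNReal.ofReal (Real.exp (birkhoffSum shift u n y.1)) * φ y.1

/-- The preimages under `σ^{m+n}` are the preimages under `σⁿ` of the preimages under `σᵐ`. -/
def preimageEquiv (m n : ℕ) (x : Shift A) :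
    (Σ z : {z : Shift A // shift^[m] z = x}, {y : Shift A // shift^[n] y = z.1}) ≃
      {y : Shift A // shift^[m + n] y = x} where
  toFun p := ⟨p.2.1, by rw [Function.iterate_add_apply, p.2.2, p.1.2]⟩
  invFun y := ⟨⟨shift^[n] y.1, by rw [← Function.iterate_add_apply, y.2]⟩, ⟨y.1, rfl⟩⟩
  left_inv := by
    rintro ⟨⟨z, hz⟩, ⟨y, hy⟩⟩
    dsimp only at hy
    subst hy
    rfl
  right_inv _ := rfl

theorem preimageSum_add (u : Shift A → ℝ) (m n : ℕ) (φ : Shift A → ℝ≥0∞) :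
    preimageSum u (m + n) φ = preimageSum u m (preimageSum u n φ) := by
  funext x
  rw [preimageSum, ← (preimageEquiv m n x).tsum_eq, ENNReal.tsum_sigma', preimageSum]
  refine tsum_congr fun z => ?_
  rw [preimageSum, ← ENNReal.tsum_mul_left]
  refine tsum_congr fun y => ?_
  have : birkhoffSum shift u (m + n) y.1 =
      birkhoffSum shift u m z.1 + birkhoffSum shift u n y.1 := by
    rw [add_comm m n, birkhoffSum_add, y.2, add_comm]
  rw [← mul_assoc, ← ENNReal.ofReal_mul (Real.exp_pos _).le, ← Real.exp_add]
  exact congrArg (fun t => ENNReal.ofReal (Real.exp t) * φ y.1) this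

theorem preimageSum_zero (u : Shift A → ℝ) (φ : Shift A → ℝ≥0∞) : preimageSum u 0 φ = φ := by
  funext x
  rw [preimageSum, tsum_eq_single (⟨x, rfl⟩ : {y : Shift A // shift^[0] y = x})]
  · simp
  · rintro ⟨y, hy⟩ h
    exact absurd (Subtype.ext hy) h

theorem preimageSum_mono (u : Shift A → ℝ) (n : ℕ) {φ ψ : Shift A → ℝ≥0∞} (h : φ ≤ ψ) :
    preimageSum u n φ ≤ preimageSum u n ψ := fun _ =>
  ENNReal.tsum_le_tsum fun y => mul_le_mul_right (h y.1) _

theorem preimageSum_add_fun (u : Shift A → ℝ) (n : ℕ) (φ ψ : Shift A → ℝ≥0∞) :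
    preimageSum u n (φ + ψ) = preimageSum u n φ + preimageSum u n ψ := by
  funext x
  simp only [preimageSum, Pi.add_apply, mul_add, ENNReal.tsum_add]

theorem preimageSum_const_mul (u : Shift A → ℝ) (n : ℕ) (c : ℝ≥0∞) (φ : Shift A → ℝ≥0∞)
    (x : Shift A) :
    preimageSum u n (fun y => c * φ y) x = c * preimageSum u n φ x := by
  simp only [preimageSum, ← ENNReal.tsum_mul_left, mul_left_comm]

theorem preimageSum_const (u : Shift A → ℝ) (n : ℕ) (c : ℝ≥0∞) (x : Shift A) :
    preimageSum u n (fun _ => c) x = c * preimageSum u n (fun _ => 1) x := by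
  rw [← preimageSum_const_mul]
  simp only [mul_one]

theorem preimageSum_le_const (u : Shift A → ℝ) (n : ℕ) {φ : Shift A → ℝ≥0∞} {c : ℝ≥0∞}
    (h : ∀ y, φ y ≤ c) (x : Shift A) :
    preimageSum u n φ x ≤ c * preimageSum u n (fun _ => 1) x := by
  rw [← preimageSum_const]
  exact preimageSum_mono u n h x

theorem const_le_preimageSum (u : Shift A → ℝ) (n : ℕ) {φ : Shift A → ℝ≥0∞} {c : ℝ≥0∞}
    (h : ∀ y, c ≤ φ y) (x : Shift A) :
    c * preimageSum u n (fun _ => 1) x ≤ preimageSum u n φ x := by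
  rw [← preimageSum_const]
  exact preimageSum_mono u n h x

theorem preimageSum_finset_sum {κ : Type*} (u : Shift A → ℝ) (n : ℕ) (s : Finset κ)
    (φ : κ → Shift A → ℝ≥0∞) (x : Shift A) :
    preimageSum u n (fun y => ∑ k ∈ s, φ k y) x = ∑ k ∈ s, preimageSum u n (φ k) x := by
  simp only [preimageSum, Finset.mul_sum]
  exact Summable.tsum_finsetSum fun _ _ => ENNReal.summable

/-! ### Finite irreducibility -/

section Connection

variable {θ : Set.Ioo (0 : ℝ) 1} {u : Shift A → ℝ}

/-- Finite irreducibility as it is used below: from the first `n` letters of `z` one can reach any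
`x` through a gap whose length is taken from a finite set, and the Birkhoff sum loses at most a
constant on the way. -/
theorem exists_connection (hA : FinitelyIrreducible A) (hu : holderSeminorm θ u < ⊤) :
    ∃ (K : Finset ℕ) (C : ℝ), ∀ n, 1 ≤ n → ∀ z x : Shift A, ∃ k ∈ K, ∃ y : Shift A,
      (∀ i < n, y.1 i = z.1 i) ∧ shift^[n + k] y = x ∧
        birkhoffSum shift u n z ≤ birkhoffSum shift u (n + k) y + C := by
  obtain ⟨Λ, hΛ, -, hΛA⟩ := hA
  have hB : ∀ l : List ι, ∃ B : ℝ, ∀ q ∈ cylinder A l, -B ≤ birkhoffSum shift u l.length q := by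
    intro l
    by_cases h : ∃ p, p ∈ cylinder A l
    · obtain ⟨p, hp⟩ := h
      refine ⟨distortion θ u - birkhoffSum shift u l.length p, fun q hq => ?_⟩
      have := birkhoffSum_le_add_distortion hu l.length (x := p) (y := q)
        fun i hi => (hp ⟨i, hi⟩).trans (hq ⟨i, hi⟩).symm
      linarith
    · exact ⟨0, fun q hq => absurd ⟨q, hq⟩ h⟩
  choose B hB using hB
  refine ⟨hΛ.toFinset.image List.length, distortion θ u + ∑ l ∈ hΛ.toFinset, |B l|,
    fun n hn z x => ?_⟩
  obtain ⟨n, rfl⟩ := Nat.exists_eq_add_of_le' hn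
  obtain ⟨l, hl, hlA⟩ := hΛA (z.1 n) (x.1 0)
  obtain ⟨N, -, t', m, ht'⟩ := Set.mem_iUnion.1 hlA
  -- `t` begins with the last of the `n + 1` letters of `z`, the word `l`, and the first letter
  -- of `x`
  set t : Shift A := shift^[m] t' with ht
  have ht0 : t.1 0 = z.1 n := ht' ⟨0, by simp⟩
  have htl : ∀ i (hi : i < l.length), t.1 (i + 1) = l[i] := by
    intro i hi
    have := ht' ⟨i + 1, by simp; omega⟩
    simpa [List.getElem_append, hi] using this
  have htx : t.1 (l.length + 1) = x.1 0 := by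
    have := ht' ⟨l.length + 1, by simp⟩
    simpa [List.getElem_append] using this
  -- `s` is the last of these letters of `z`, then `l`, then `x`; and `y` is `z` continued by `s`
  set s := glue t (l.length + 1) x htx with hs
  have hs0 : z.1 n = s.1 0 := by rw [hs, glue_apply_of_le _ _ _ _ (Nat.zero_le _), ht0]
  set y := glue z n s hs0 with hy
  have hyz : ∀ i < n + 1, y.1 i = z.1 i := fun i hi => glue_apply_of_le _ _ _ _ (by omega)
  have hys : shift^[n + 1] y = shift s := by
    rw [Function.iterate_succ_apply', hy, shift_iterate_glue]
  refine ⟨l.length, Finset.mem_image_of_mem _ (hΛ.mem_toFinset.2 hl), y, hyz, ?_, ?_⟩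
  · rw [add_comm, Function.iterate_add_apply, hys, ← Function.iterate_succ_apply, hs,
      shift_iterate_glue]
  · have h1 := birkhoffSum_le_add_distortion hu (n + 1) (x := z) (y := y)
      fun i hi => (hyz i hi).symm
    have h2 : -B l ≤ birkhoffSum shift u l.length (shift s) := by
      refine hB l _ fun k => ?_
      have : s.1 (k + 1) = t.1 (k + 1) := glue_apply_of_le _ _ _ _ (by omega)
      exact this.trans (htl k k.2)
    have h3 : |B l| ≤ ∑ l ∈ hΛ.toFinset, |B l| :=
      Finset.single_le_sum (f := fun l => |B l|) (fun _ _ => abs_nonneg _)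
        (hΛ.mem_toFinset.2 hl)
    rw [birkhoffSum_add shift u (n + 1), hys]
    linarith [le_abs_self (B l)]

/-- The iterates of the Perron-Frobenius operator charge every cylinder, uniformly in the point. -/
theorem exists_le_sum_preimageSum_indicator (hA : FinitelyIrreducible A)
    (hu : holderSeminorm θ u < ⊤) :
    ∃ K : Finset ℕ, ∀ n, 1 ≤ n → ∀ z : Shift A, ∃ c : ℝ≥0∞, c ≠ 0 ∧ ∀ x,
      c ≤ ∑ k ∈ K, preimageSum u (n + k) ((cylinder A (wordOf n z).1).indicator 1) x := by
  obtain ⟨K, C, hK⟩ := exists_connection hA hu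
  refine ⟨K, fun n hn z => ⟨ENNReal.ofReal (Real.exp (birkhoffSum shift u n z - C)),
    by simpa using Real.exp_pos _, fun x => ?_⟩⟩
  obtain ⟨k, hk, y, hyz, hyx, hy⟩ := hK n hn z x
  calc ENNReal.ofReal (Real.exp (birkhoffSum shift u n z - C))
      ≤ ENNReal.ofReal (Real.exp (birkhoffSum shift u (n + k) y)) *
        (cylinder A (wordOf n z).1).indicator 1 y := by
        rw [Set.indicator_of_mem (mem_cylinder_wordOf.2 hyz), Pi.one_apply, mul_one]
        exact ENNReal.ofReal_le_ofReal (Real.exp_le_exp.2 (by linarith))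
    _ ≤ preimageSum u (n + k) ((cylinder A (wordOf n z).1).indicator 1) x :=
        ENNReal.le_tsum (f := fun y : {y : Shift A // shift^[n + k] y = x} =>
          ENNReal.ofReal (Real.exp (birkhoffSum shift u (n + k) y.1)) *
            (cylinder A (wordOf n z).1).indicator 1 y.1) ⟨y, hyx⟩
    _ ≤ _ := Finset.single_le_sum
        (f := fun k => preimageSum u (n + k) ((cylinder A (wordOf n z).1).indicator 1) x)
        (fun _ _ => zero_le) hk

end Connection

/-! ### Growth of the partition function -/

section Growth

variable {θ : Set.Ioo (0 : ℝ) 1} {u : Shift A → ℝ}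

theorem ofReal_exp_birkhoffSum_le (u : Shift A → ℝ) (n : ℕ) (y : Shift A) :
    ENNReal.ofReal (Real.exp (birkhoffSum shift u n y)) ≤
      EReal.exp (⨆ x ∈ cylinder A (wordOf n y).1, ((birkhoffSum shift u n x : ℝ) : EReal)) := by
  rw [← EReal.exp_coe]
  exact EReal.exp_monotone
    (le_iSup₂ (f := fun x (_ : x ∈ cylinder A (wordOf n y).1) =>
      ((birkhoffSum shift u n x : ℝ) : EReal)) y (mem_cylinder_wordOf.2 fun _ _ => rfl))

theorem preimageSum_one_le_partitionFunction (u : Shift A → ℝ) (n : ℕ) (x : Shift A) :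
    preimageSum u n (fun _ => 1) x ≤ partitionFunction u n := by
  have hinj : Function.Injective
      fun y : {y : Shift A // shift^[n] y = x} => wordOf n y.1 := fun y y' h =>
    Subtype.ext (eq_of_shift_iterate_eq (y.2.trans y'.2.symm) (wordOf_eq_wordOf_iff.1 h))
  refine le_trans ?_ (ENNReal.tsum_comp_le_tsum_of_injective hinj _)
  refine ENNReal.tsum_le_tsum fun y => ?_
  rw [mul_one]
  exact ofReal_exp_birkhoffSum_le u n y.1

/-- The sum `∑_e exp (sup_{[e]} u)`, with values in `[0, ∞]`. -/
def letterSum (u : Shift A → ℝ) : ℝ≥0∞ :=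
  ∑' e : ι, EReal.exp (⨆ x ∈ cylinder A [e], ((u x : ℝ) : EReal))

theorem preimageSum_one_le_letterSum (u : Shift A → ℝ) (x : Shift A) :
    preimageSum u 1 (fun _ => 1) x ≤ letterSum u := by
  have hinj : Function.Injective fun y : {y : Shift A // shift^[1] y = x} => y.1.1 0 :=
    fun y y' h => Subtype.ext (eq_of_shift_iterate_eq (y.2.trans y'.2.symm) (by simpa using h))
  refine le_trans ?_ (ENNReal.tsum_comp_le_tsum_of_injective hinj _)
  refine ENNReal.tsum_le_tsum fun y => ?_
  rw [mul_one, birkhoffSum_one, ← EReal.exp_coe]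
  refine EReal.exp_monotone
    (le_iSup₂ (f := fun x (_ : x ∈ cylinder A [y.1.1 0]) => ((u x : ℝ) : EReal)) y.1 fun k => ?_)
  obtain ⟨k, hk⟩ := k
  obtain rfl : k = 0 := Nat.lt_one_iff.1 hk
  rfl

theorem preimageSum_one_le_pow (u : Shift A → ℝ) (n : ℕ) (x : Shift A) :
    preimageSum u n (fun _ => 1) x ≤ letterSum u ^ n := by
  induction n generalizing x with
  | zero => simp [preimageSum_zero]
  | succ n ih =>
    rw [add_comm, preimageSum_add]
    refine (preimageSum_le_const u 1 ih x).trans ?_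
    rw [add_comm, pow_succ]
    exact mul_le_mul_right (preimageSum_one_le_letterSum u x) _

/-- The partition function is comparable with the iterates of the Perron-Frobenius operator at
any point. -/
theorem exists_partitionFunction_le (hA : FinitelyIrreducible A) (hu : holderSeminorm θ u < ⊤)
    (hs : IsSummable u) :
    ∃ C : ℝ≥0∞, C ≠ ⊤ ∧ 1 ≤ C ∧ ∀ n, 1 ≤ n → ∀ x,
      partitionFunction u n ≤ C * preimageSum u n (fun _ => 1) x := by
  obtain ⟨K, C, hK⟩ := exists_connection hA hu
  set E : ℝ≥0∞ := ENNReal.ofReal (Real.exp (C + distortion θ u)) with hE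
  refine ⟨1 + E * ∑ k ∈ K, letterSum u ^ k, ?_, le_self_add, fun n hn x => ?_⟩
  · have : letterSum u ≠ ⊤ := ne_of_lt hs
    have hsum : ∑ k ∈ K, letterSum u ^ k ≠ ⊤ :=
      ENNReal.sum_ne_top.2 fun k _ => ENNReal.pow_ne_top this
    finiteness
  -- each word `w` is completed to a preimage `y w` of `x`, from which `w` can be recovered
  choose k hk y hyz hyx hy using fun w : words A n => hK n hn (basePoint w) x
  let F : (Σ j : K, {y : Shift A // shift^[n + j.1] y = x}) → ℝ≥0∞ := fun p =>
    ENNReal.ofReal (Real.exp (birkhoffSum shift u (n + p.1.1) p.2.1))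
  let i : words A n → Σ j : K, {y : Shift A // shift^[n + j.1] y = x} := fun w =>
    ⟨⟨k w, hk w⟩, ⟨y w, hyx w⟩⟩
  have hi : Function.Injective i := by
    intro w w' h
    have h' : (i w).2.1 = (i w').2.1 := by rw [h]
    have hw : ∀ w, wordOf n (i w).2.1 = w := fun w => by
      conv_rhs => rw [← wordOf_basePoint w]
      exact wordOf_eq_wordOf_iff.2 (hyz w)
    rw [← hw w, ← hw w', h']
  calc partitionFunction u n
      ≤ ∑' w : words A n, E * F (i w) := by
        refine ENNReal.tsum_le_tsum fun w => ?_
        rw [hE, ← ENNReal.ofReal_mul (Real.exp_pos _).le, ← Real.exp_add, ← EReal.exp_coe]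
        refine EReal.exp_monotone (iSup₂_le fun q hq => EReal.coe_le_coe_iff.2 ?_)
        have h1 := birkhoffSum_le_add_distortion hu n (x := q) (y := basePoint w) (by
          rw [← wordOf_eq_wordOf_iff, wordOf_basePoint]
          exact wordOf_eq_iff.2 hq)
        have h2 := hy w
        simp only [i]
        linarith
    _ = E * ∑' w : words A n, F (i w) := ENNReal.tsum_mul_left
    _ ≤ E * ∑' p, F p := mul_le_mul_right (ENNReal.tsum_comp_le_tsum_of_injective hi F) _
    _ = E * ∑ j ∈ K, preimageSum u (n + j) (fun _ => 1) x := by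
        rw [ENNReal.tsum_sigma', tsum_fintype, ← Finset.sum_coe_sort K]
        simp only [F, preimageSum, mul_one]
    _ ≤ E * ∑ j ∈ K, letterSum u ^ j * preimageSum u n (fun _ => 1) x := by
        gcongr with j hj
        rw [preimageSum_add]
        exact preimageSum_le_const u n (preimageSum_one_le_pow u j) x
    _ = (E * ∑ j ∈ K, letterSum u ^ j) * preimageSum u n (fun _ => 1) x := by
        rw [← Finset.sum_mul, mul_assoc]
    _ ≤ _ := by gcongr; exact le_add_self

/-- A sequence that is additive up to a bounded error is linear up to the same error. -/
theorem exists_abs_sub_mul_le {l : ℕ → ℝ} {c : ℝ} (hl : ∀ m n, |l (m + n) - l m - l n| ≤ c) :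
    ∃ P : ℝ, ∀ n : ℕ, |l n - n * P| ≤ c := by
  have h1 : Subadditive fun n => l n + c := fun m n => by
    have := (abs_le.1 (hl m n)).2
    linarith
  have h2 : Subadditive fun n => c - l n := fun m n => by
    have := (abs_le.1 (hl m n)).1
    linarith
  have hbd : ∀ n : ℕ, |l n| ≤ n * (|l 1| + c + |l 0|) + |l 0| := by
    intro n
    induction n with
    | zero => simp
    | succ n ih =>
      have h := hl n 1
      have : |l (n + 1)| ≤ |l (n + 1) - l n - l 1| + |l n| + |l 1| := by
        calc |l (n + 1)| = |(l (n + 1) - l n - l 1) + l n + l 1| := by congr 1; ring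
          _ ≤ _ := abs_add_three _ _ _
      push_cast
      linarith [abs_nonneg (l 0)]
  have hc : 0 ≤ c := (abs_nonneg _).trans (hl 0 0)
  set M := |l 1| + c + |l 0| + |l 0| + c with hM
  have hdiv : ∀ n : ℕ, ∀ a : ℝ, |a| ≤ |l n| + c → -M ≤ a / n := by
    intro n a ha
    rcases Nat.eq_zero_or_pos n with rfl | hn
    · simp only [Nat.cast_zero, div_zero]
      have := abs_nonneg (l 0)
      have := abs_nonneg (l 1)
      linarith
    · have hn1 : (1 : ℝ) ≤ n := by exact_mod_cast hn
      rw [le_div_iff₀ (by linarith)]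
      have h0 := hbd n
      have h4 := (abs_le.1 ha).1
      have h5 : |l 0| + c ≤ n * (|l 0| + c) := le_mul_of_one_le_left (by positivity) hn1
      rw [hM]
      linarith
  have b1 : BddBelow (Set.range fun n : ℕ => (l n + c) / n) := by
    refine ⟨-M, ?_⟩
    rintro _ ⟨n, rfl⟩
    exact hdiv n _ ((abs_add_le _ _).trans (by rw [abs_of_nonneg hc]))
  have b2 : BddBelow (Set.range fun n : ℕ => (c - l n) / n) := by
    refine ⟨-M, ?_⟩
    rintro _ ⟨n, rfl⟩
    exact hdiv n _ ((abs_sub _ _).trans (by rw [abs_of_nonneg hc, add_comm]))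
  -- Fekete's lemma bounds `l` from one side and `-l` from the other, with the same slope
  have hlim : h2.lim = -h1.lim := by
    have t1 := h1.tendsto_lim b1
    have t2 := h2.tendsto_lim b2
    have t3 : Tendsto (fun n : ℕ => (2 * c) / (n : ℝ)) atTop (𝓝 0) :=
      tendsto_const_div_atTop_nhds_zero_nat _
    have t4 := t1.add t2
    have : (fun n : ℕ => (l n + c) / n + (c - l n) / n) = fun n : ℕ => (2 * c) / (n : ℝ) := by
      funext n
      ring
    rw [this] at t4
    linarith [tendsto_nhds_unique t3 t4]
  refine ⟨h1.lim, fun n => ?_⟩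
  rcases Nat.eq_zero_or_pos n with rfl | hn
  · have := hl 0 0
    simpa using this
  · have hn0 : (0 : ℝ) < n := by exact_mod_cast hn
    have e1 := h1.lim_le_div b1 hn.ne'
    have e2 := h2.lim_le_div b2 hn.ne'
    rw [hlim] at e2
    rw [le_div_iff₀ hn0] at e1 e2
    rw [abs_le]
    constructor <;> linarith

/-- The pressure exists, and the iterates of the Perron-Frobenius operator on the constant function
`1` grow like `exp (n P)` up to a constant factor. -/
theorem exists_hasPressure [Nonempty (Shift A)] (hA : FinitelyIrreducible A)
    (hu : holderSeminorm θ u < ⊤) (hs : IsSummable u) :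
    ∃ P C : ℝ, 0 < C ∧ HasPressure u P ∧
      (∀ n x, preimageSum u n (fun _ => 1) x ≤ ENNReal.ofReal (C * Real.exp (n * P))) ∧
      (∀ (n : ℕ) x, ENNReal.ofReal (C⁻¹ * Real.exp (n * P)) ≤ preimageSum u n (fun _ => 1) x) ∧
      ∀ n, 1 ≤ n → partitionFunction u n ≤ ENNReal.ofReal (C * Real.exp (n * P)) := by
  obtain ⟨C, hCt, hC1, hC⟩ := exists_partitionFunction_le hA hu hs
  let x₀ : Shift A := Classical.arbitrary _
  have hle : ∀ n x x', preimageSum u n (fun _ => 1) x ≤ C * preimageSum u n (fun _ => 1) x' := by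
    intro n x x'
    rcases Nat.eq_zero_or_pos n with rfl | hn
    · simpa [preimageSum_zero] using hC1
    · exact (preimageSum_one_le_partitionFunction u n x).trans (hC n hn x')
  have htop : ∀ n x, preimageSum u n (fun _ => 1) x ≠ ⊤ := fun n x =>
    ne_top_of_le_ne_top (ENNReal.pow_ne_top (ne_of_lt hs)) (preimageSum_one_le_pow u n x)
  have hpos : ∀ n x, preimageSum u n (fun _ => 1) x ≠ 0 := by
    intro n x h0
    have h1 := hle n (shift^[n] x₀) x
    rw [h0, mul_zero] at h1
    have h2 := ENNReal.le_tsum (f := fun y : {y : Shift A // shift^[n] y = shift^[n] x₀} =>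
      ENNReal.ofReal (Real.exp (birkhoffSum shift u n y.1)) * 1) ⟨x₀, rfl⟩
    have h3 := h2.trans h1
    rw [mul_one, nonpos_iff_eq_zero, ENNReal.ofReal_eq_zero] at h3
    exact absurd (Real.exp_pos _) (not_lt.2 h3)
  set p : ℕ → ℝ := fun n => (preimageSum u n (fun _ => 1) x₀).toReal with hp
  have hp0 : ∀ n, 0 < p n := fun n => ENNReal.toReal_pos (hpos n x₀) (htop n x₀)
  set D : ℝ := C.toReal with hD
  have hD1 : 1 ≤ D := by
    rw [hD, ← ENNReal.toReal_one]
    exact ENNReal.toReal_mono hCt hC1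
  have hD0 : 0 < D := by linarith
  have hup : ∀ m n, p (m + n) ≤ D * (p m * p n) := by
    intro m n
    rw [hp, hD]
    simp only
    rw [← ENNReal.toReal_mul, ← ENNReal.toReal_mul]
    refine ENNReal.toReal_mono (ENNReal.mul_ne_top hCt
      (ENNReal.mul_ne_top (htop _ _) (htop _ _))) ?_
    rw [preimageSum_add]
    refine (preimageSum_le_const u m (fun y => hle n y x₀) x₀).trans (le_of_eq ?_)
    ring
  have hlow : ∀ m n, p m * p n ≤ D * p (m + n) := by
    intro m n
    rw [hp, hD]
    simp only
    rw [← ENNReal.toReal_mul, ← ENNReal.toReal_mul]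
    refine ENNReal.toReal_mono (ENNReal.mul_ne_top hCt (htop _ _)) ?_
    rw [preimageSum_add, mul_comm, ← preimageSum_const_mul u m C]
    exact const_le_preimageSum u m (fun y => hle n x₀ y) x₀
  -- the values at `x₀` are multiplicative up to the factor `D`, hence exponential up to it
  obtain ⟨P, hP⟩ := exists_abs_sub_mul_le (l := fun n => Real.log (p n)) (c := Real.log D) (by
    intro m n
    have h1 := Real.log_le_log (hp0 _) (hup m n)
    have h2 := Real.log_le_log (mul_pos (hp0 m) (hp0 n)) (hlow m n)
    rw [Real.log_mul hD0.ne' (mul_pos (hp0 m) (hp0 n)).ne',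
      Real.log_mul (hp0 m).ne' (hp0 n).ne'] at h1
    rw [Real.log_mul hD0.ne' (hp0 _).ne', Real.log_mul (hp0 m).ne' (hp0 n).ne'] at h2
    rw [abs_le]
    constructor <;> linarith)
  have hpu : ∀ n : ℕ, p n ≤ D * Real.exp (n * P) := by
    intro n
    have := (abs_le.1 (hP n)).2
    rw [← Real.exp_log hD0, ← Real.exp_add, ← Real.log_le_iff_le_exp (hp0 n)]
    linarith
  have hpl : ∀ n : ℕ, D⁻¹ * Real.exp (n * P) ≤ p n := by
    intro n
    have := (abs_le.1 (hP n)).1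
    have h : -Real.log D + n * P ≤ Real.log (p n) := by linarith
    rwa [Real.le_log_iff_exp_le (hp0 n), Real.exp_add, Real.exp_neg, Real.exp_log hD0] at h
  have hpE : ∀ n, ENNReal.ofReal (p n) = preimageSum u n (fun _ => 1) x₀ := fun n =>
    ENNReal.ofReal_toReal (htop n x₀)
  have hCE : ENNReal.ofReal D = C := ENNReal.ofReal_toReal hCt
  have hDD : D ≤ D ^ 2 := by nlinarith
  have hup' : ∀ n x, preimageSum u n (fun _ => 1) x ≤
      ENNReal.ofReal (D ^ 2 * Real.exp (n * P)) := by
    intro n x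
    refine (hle n x x₀).trans ?_
    rw [← hpE, ← hCE, ← ENNReal.ofReal_mul hD0.le]
    refine ENNReal.ofReal_le_ofReal ?_
    calc D * p n ≤ D * (D * Real.exp (n * P)) := by gcongr; exact hpu n
      _ = _ := by ring
  have hZ : ∀ n, 1 ≤ n → partitionFunction u n ≤ ENNReal.ofReal (D ^ 2 * Real.exp (n * P)) := by
    intro n hn
    refine (hC n hn x₀).trans ?_
    rw [← hpE, ← hCE, ← ENNReal.ofReal_mul hD0.le]
    refine ENNReal.ofReal_le_ofReal ?_
    calc D * p n ≤ D * (D * Real.exp (n * P)) := by gcongr; exact hpu n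
      _ = _ := by ring
  have hlo : ∀ (n : ℕ) x, ENNReal.ofReal ((D ^ 2)⁻¹ * Real.exp (n * P)) ≤
      preimageSum u n (fun _ => 1) x := by
    intro n x
    have h1 := hle n x₀ x
    rw [← hpE, ← hCE, ← ENNReal.ofReal_toReal (htop n x), ← ENNReal.ofReal_mul hD0.le,
      ENNReal.ofReal_le_ofReal_iff (mul_nonneg hD0.le ENNReal.toReal_nonneg)] at h1
    rw [← ENNReal.ofReal_toReal (htop n x)]
    refine ENNReal.ofReal_le_ofReal ?_
    have h2 := (hpl n).trans h1
    rw [inv_mul_le_iff₀ hD0] at h2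
    rw [inv_mul_le_iff₀ (by positivity)]
    linarith
  refine ⟨P, D ^ 2, by positivity, ?_, hup', hlo, hZ⟩
  -- the logarithm of the partition function lies between `n P - log D ^ 2` and `n P + log D ^ 2`
  have hZt : ∀ n, 1 ≤ n → partitionFunction u n ≠ ⊤ := fun n hn =>
    ne_top_of_le_ne_top ENNReal.ofReal_ne_top (hZ n hn)
  have hZl : ∀ n : ℕ, 1 ≤ n → ENNReal.ofReal ((D ^ 2)⁻¹ * Real.exp (n * P)) ≤
      partitionFunction u n := fun n hn =>
    (hlo n x₀).trans (preimageSum_one_le_partitionFunction u n x₀)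
  set c := Real.log (D ^ 2) with hc
  have hexp : D ^ 2 = Real.exp c := (Real.exp_log (by positivity)).symm
  have key : ∀ n : ℕ, 1 ≤ n → ∃ t : ℝ, |t| ≤ c ∧
      ENNReal.log (partitionFunction u n) / (n : EReal) = ((P + t / n : ℝ) : EReal) := by
    intro n hn
    have hn0 : (n : ℝ) ≠ 0 := by positivity
    have hz0 : 0 < (partitionFunction u n).toReal :=
      ENNReal.toReal_pos (fun h => by
        have := hZl n hn
        rw [h, nonpos_iff_eq_zero, ENNReal.ofReal_eq_zero] at this
        exact absurd (show 0 < (D ^ 2)⁻¹ * Real.exp (n * P) by positivity) (not_lt.2 this))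
        (hZt n hn)
    refine ⟨Real.log (partitionFunction u n).toReal - n * P, abs_le.2 ⟨?_, ?_⟩, ?_⟩
    · have := (ENNReal.ofReal_le_iff_le_toReal (hZt n hn)).1 (hZl n hn)
      rw [hexp, ← Real.exp_neg, ← Real.exp_add, ← Real.le_log_iff_exp_le hz0] at this
      linarith
    · have := ENNReal.toReal_le_of_le_ofReal (by positivity) (hZ n hn)
      rw [hexp, ← Real.exp_add, ← Real.log_le_iff_le_exp hz0] at this
      linarith
    · rw [← ENNReal.ofReal_toReal (hZt n hn), ENNReal.log_ofReal_of_pos hz0,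
        ENNReal.toReal_ofReal hz0.le]
      rw [show ((n : ℕ) : EReal) = ((n : ℝ) : EReal) from rfl, ← EReal.coe_div]
      congr 1
      field_simp
      ring
  choose! t ht ht' using key
  have hlim : Tendsto (fun n : ℕ => P + t n / n) atTop (𝓝 P) := by
    have : Tendsto (fun n : ℕ => t n / n) atTop (𝓝 0) := by
      refine squeeze_zero_norm' ?_ (tendsto_const_div_atTop_nhds_zero_nat c)
      filter_upwards [eventually_ge_atTop 1] with n hn
      rw [Real.norm_eq_abs, abs_div, Nat.abs_cast]
      gcongr
      exact ht n hn
    simpa using this.const_add P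
  refine Tendsto.congr' ?_ (EReal.tendsto_coe.2 hlim)
  filter_upwards [eventually_ge_atTop 1] with n hn
  exact (ht' n hn).symm

end Growth

/-! ### The Banach space of bounded Hölder functions -/

namespace HolderSpace

variable [TopologicalSpace ι] {θ : Set.Ioo (0 : ℝ) 1}

theorem norm_apply_le (g : HolderSpace A θ) (x : Shift A) : ‖g x‖ ≤ ‖g‖ := by
  refine (g.toBCF.norm_coe_le_norm x).trans ?_
  rw [norm_def]
  linarith [ENNReal.toReal_nonneg (a := holderSeminorm θ (g : Shift A → ℂ))]

theorem norm_apply_sub_le (g : HolderSpace A θ) {n : ℕ} (hn : 1 ≤ n) {x y : Shift A}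
    (hxy : ∀ i < n, x.1 i = y.1 i) : ‖g x - g y‖ ≤ ‖g‖ * (θ : ℝ) ^ n := by
  have hθ : 0 < (θ : ℝ) := θ.2.1
  refine (norm_sub_le_of_holder g.holder hn hxy).trans ?_
  gcongr
  rw [norm_def]
  linarith [norm_nonneg g.toBCF]

theorem exists_norm_sub_lt (g : HolderSpace A θ) {ε : ℝ} (hε : 0 < ε) :
    ∃ n, 1 ≤ n ∧ ∀ x y : Shift A, (∀ i < n, x.1 i = y.1 i) → ‖g x - g y‖ < ε := by
  have hlim : Tendsto (fun n : ℕ => ‖g‖ * (θ : ℝ) ^ n) atTop (𝓝 0) := by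
    simpa using (tendsto_pow_atTop_nhds_zero_of_lt_one θ.2.1.le θ.2.2).const_mul ‖g‖
  obtain ⟨n, hn, hn1⟩ := ((hlim.eventually_lt_const hε).and (eventually_ge_atTop 1)).exists
  exact ⟨n, hn1, fun x y hxy => (g.norm_apply_sub_le hn1 hxy).trans_lt hn⟩

theorem norm_le_of_forall {g : HolderSpace A θ} {a b : ℝ} (ha : 0 ≤ a) (hb : 0 ≤ b)
    (hga : ∀ x, ‖g x‖ ≤ a)
    (hgb : ∀ n, 1 ≤ n → ∀ x y : Shift A, (∀ i < n, x.1 i = y.1 i) →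
      ‖g x - g y‖ ≤ b * (θ : ℝ) ^ n) : ‖g‖ ≤ a + b := by
  rw [norm_def, add_comm]
  exact add_le_add ((BoundedContinuousFunction.norm_le ha).2 hga)
    (holderSeminorm_toReal_le hb hgb).2

/-- A bounded function which satisfies a Hölder estimate, as an element of the Hölder space. -/
def ofBounds [DiscreteTopology ι] (g : Shift A → ℂ) (a : ℝ) {b : ℝ} (hb : 0 ≤ b)
    (hga : ∀ x, ‖g x‖ ≤ a)
    (hgb : ∀ n, 1 ≤ n → ∀ x y : Shift A, (∀ i < n, x.1 i = y.1 i) →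
      ‖g x - g y‖ ≤ b * (θ : ℝ) ^ n) : HolderSpace A θ :=
  ⟨BoundedContinuousFunction.ofNormedAddCommGroup g
    (continuous_of_holder (holderSeminorm_toReal_le hb hgb).1) a hga,
    (holderSeminorm_toReal_le hb hgb).1⟩

theorem smul_apply (c : ℂ) (g : HolderSpace A θ) (x : Shift A) : (c • g) x = c * g x := rfl

theorem sub_apply (g h : HolderSpace A θ) (x : Shift A) : (g - h) x = g x - h x := rfl

/-- Evaluation at a point, as a continuous linear functional. -/
def evalCLM (θ : Set.Ioo (0 : ℝ) 1) (x : Shift A) : HolderSpace A θ →L[ℂ] ℂ :=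
  LinearMap.mkContinuous
    { toFun := fun g => g x
      map_add' := fun _ _ => rfl
      map_smul' := fun _ _ => rfl } 1 (fun g => by
      rw [one_mul]
      exact norm_apply_le g x)

theorem norm_evalCLM_le (x : Shift A) : ‖evalCLM (A := A) θ x‖ ≤ 1 :=
  LinearMap.mkContinuous_norm_le _ zero_le_one _

/-- Pointwise limits inherit the Hölder estimates, so completeness follows from that of `ℂ`. -/
instance [DiscreteTopology ι] : CompleteSpace (HolderSpace A θ) := by
  refine Metric.complete_of_cauchySeq_tendsto fun g hg => ?_
  have hx : ∀ x, ∃ c : ℂ, Tendsto (fun k => g k x) atTop (𝓝 c) := fun x =>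
    cauchySeq_tendsto_of_complete (hg.map (evalCLM θ x).uniformContinuous)
  choose G hG using hx
  obtain ⟨M, hM⟩ := hg.norm_bddAbove
  have hM' : ∀ k, ‖g k‖ ≤ M := fun k => hM ⟨k, rfl⟩
  have hM0 : 0 ≤ M := (norm_nonneg _).trans (hM' 0)
  have hθ : 0 < (θ : ℝ) := θ.2.1
  let L : HolderSpace A θ := ofBounds G M hM0
    (fun x => le_of_tendsto (hG x).norm (Eventually.of_forall fun k =>
      (norm_apply_le _ x).trans (hM' k)))
    (fun n hn x y hxy => le_of_tendsto ((hG x).sub (hG y)).norm (Eventually.of_forall fun k =>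
      (norm_apply_sub_le (g k) hn hxy).trans (by gcongr; exact hM' k)))
  have hL : ∀ x, L x = G x := fun _ => rfl
  refine ⟨L, Metric.tendsto_atTop.2 fun ε hε => ?_⟩
  obtain ⟨N, hN⟩ := Metric.cauchySeq_iff.1 hg (ε / 3) (by positivity)
  refine ⟨N, fun k hk => ?_⟩
  rw [dist_eq_norm]
  have hkl : ∀ l ≥ N, ‖g k - g l‖ ≤ ε / 3 := fun l hl => by
    rw [← dist_eq_norm]
    exact (hN k hk l hl).le
  have : ‖g k - L‖ ≤ ε / 3 + ε / 3 := by
    refine norm_le_of_forall (by positivity) (by positivity) (fun x => ?_)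
      (fun n hn x y hxy => ?_)
    · rw [sub_apply, hL]
      refine le_of_tendsto ((hG x).const_sub (g k x)).norm ?_
      filter_upwards [eventually_ge_atTop N] with l hl
      exact (norm_apply_le (g k - g l) x).trans (hkl l hl)
    · rw [sub_apply, sub_apply, hL, hL]
      refine le_of_tendsto (((hG x).const_sub (g k x)).sub ((hG y).const_sub (g k y))).norm ?_
      filter_upwards [eventually_ge_atTop N] with l hl
      refine (norm_apply_sub_le (g k - g l) hn hxy).trans ?_
      gcongr
      exact hkl l hl
  linarith

end HolderSpace

/-! ### Iterates of the Perron-Frobenius operator -/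

section Iterates

/-- The letters that may precede `x` correspond to the preimages of `x` under the shift. -/
def consEquiv (x : Shift A) : {e : ι // A e (x.1 0)} ≃ {y : Shift A // shift^[1] y = x} where
  toFun e := ⟨cons e.1 x e.2, rfl⟩
  invFun y := ⟨y.1.1 0, by
    have := y.1.2 0
    rwa [show y.1.1 (0 + 1) = x.1 0 from congrArg (fun z : Shift A => z.1 0) y.2] at this⟩
  left_inv _ := rfl
  right_inv y := by
    obtain ⟨y, rfl⟩ := y
    refine Subtype.ext (Subtype.ext (funext fun n => ?_))
    cases n <;> rfl

theorem transfer_eq_tsum (f g : Shift A → ℂ) (x : Shift A) :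
    transfer f g x = ∑' y : {y : Shift A // shift^[1] y = x}, Complex.exp (f y.1) * g y.1 :=
  (consEquiv x).tsum_eq fun y : {y : Shift A // shift^[1] y = x} => Complex.exp (f y.1) * g y.1

theorem summable_exp_birkhoffSum {u : Shift A → ℝ} (hs : IsSummable u) (n : ℕ) (x : Shift A) :
    Summable fun y : {y : Shift A // shift^[n] y = x} => Real.exp (birkhoffSum shift u n y.1) := by
  have h := (preimageSum_one_le_pow u n x).trans_lt (ENNReal.pow_lt_top (n := n) hs)
  refine (ENNReal.summable_toReal h.ne).congr fun y => ?_
  rw [mul_one, ENNReal.toReal_ofReal (Real.exp_pos _).le]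

theorem re_birkhoffSum (f : Shift A → ℂ) (n : ℕ) (x : Shift A) :
    (birkhoffSum shift f n x).re = birkhoffSum shift (fun x => (f x).re) n x := by
  simp [birkhoffSum]

theorem norm_exp_birkhoffSum (f : Shift A → ℂ) (n : ℕ) (x : Shift A) :
    ‖Complex.exp (birkhoffSum shift f n x)‖ =
      Real.exp (birkhoffSum shift (fun x => (f x).re) n x) := by
  rw [Complex.norm_exp, re_birkhoffSum]

theorem summable_exp_birkhoffSum_mul {f : Shift A → ℂ} (hs : IsSummable fun x => (f x).re)
    (n : ℕ) (x : Shift A) {g : Shift A → ℂ} {C : ℝ} (hg : ∀ y, ‖g y‖ ≤ C) :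
    Summable fun y : {y : Shift A // shift^[n] y = x} =>
      Complex.exp (birkhoffSum shift f n y.1) * g y.1 := by
  refine Summable.of_norm_bounded ((summable_exp_birkhoffSum hs n x).mul_right C) fun y => ?_
  rw [norm_mul, norm_exp_birkhoffSum]
  gcongr
  exact hg y.1

variable [TopologicalSpace ι] [DiscreteTopology ι] {θ : Set.Ioo (0 : ℝ) 1} {f : Shift A → ℂ}

theorem perronFrobenius_pow_apply (hf : IsHolder θ f) (hu : IsSummable fun x => (f x).re) (n : ℕ)
    (g : HolderSpace A θ) (x : Shift A) :
    ((perronFrobenius hf hu ^ n) g) x = ∑' y : {y : Shift A // shift^[n] y = x},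
      Complex.exp (birkhoffSum shift f n y.1) * g y.1 := by
  induction n generalizing x with
  | zero =>
    rw [tsum_eq_single (⟨x, rfl⟩ : {y : Shift A // shift^[0] y = x})]
    · simp
    · rintro ⟨y, hy⟩ h
      exact absurd (Subtype.ext hy) h
  | succ n ih =>
    have hterm : ∀ (z : {z : Shift A // shift^[1] z = x})
        (y : {y : Shift A // shift^[n] y = z.1}),
        Complex.exp (f z.1) * (Complex.exp (birkhoffSum shift f n y.1) * g y.1) =
          Complex.exp (birkhoffSum shift f (1 + n) y.1) * g y.1 := fun z y => by
      rw [add_comm 1 n, birkhoffSum_succ, y.2, ← mul_assoc, ← Complex.exp_add,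
        add_comm (f z.1)]
    have hsum := (preimageEquiv 1 n x).summable_iff.2
      (summable_exp_birkhoffSum_mul hu (1 + n) x (g.norm_apply_le))
    rw [Function.comp_def] at hsum
    rw [pow_succ', mul_apply_eq_comp, perronFrobenius_apply, transfer_eq_tsum,
      add_comm n 1, ← (preimageEquiv 1 n x).tsum_eq, hsum.tsum_sigma]
    refine tsum_congr fun z => ?_
    rw [ih, ← tsum_mul_left]
    exact tsum_congr fun y => hterm z y

end Iterates

/-! ### Inverse branches -/

section Branches

variable {n : ℕ}

open Classical in
/-- The value of `G` at the preimage `w x` of `x` under `σⁿ` that begins with the word `w`, and `0`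
if there is no such preimage. -/
def branch (w : words A n) (G : Shift A → ℂ) (x : Shift A) : ℂ :=
  if h : ∃ y : Shift A, shift^[n] y = x ∧ wordOf n y = w then G h.choose else 0

theorem branch_eq {w : words A n} (G : Shift A → ℂ) {x y : Shift A} (hx : shift^[n] y = x)
    (hw : wordOf n y = w) : branch w G x = G y := by
  have h : ∃ y : Shift A, shift^[n] y = x ∧ wordOf n y = w := ⟨y, hx, hw⟩
  rw [branch, dif_pos h]
  congr 1
  exact eq_of_shift_iterate_eq (h.choose_spec.1.trans hx.symm)
    (wordOf_eq_wordOf_iff.1 (h.choose_spec.2.trans hw.symm))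

theorem branch_eq_zero {w : words A n} (G : Shift A → ℂ) {x : Shift A}
    (h : ¬ ∃ y : Shift A, shift^[n] y = x ∧ wordOf n y = w) : branch w G x = 0 := dif_neg h

theorem branch_sub_const_mul (w : words A n) (G H : Shift A → ℂ) (c : ℂ) (x : Shift A) :
    branch w (fun y => G y * (H y - c)) x = branch w (fun y => G y * H y) x - c * branch w G x := by
  by_cases h : ∃ y : Shift A, shift^[n] y = x ∧ wordOf n y = w
  · obtain ⟨y, hx, hw⟩ := h
    rw [branch_eq _ hx hw, branch_eq _ hx hw, branch_eq _ hx hw]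
    ring
  · rw [branch_eq_zero _ h, branch_eq_zero _ h, branch_eq_zero _ h]
    simp

theorem norm_branch_le {w : words A n} {G : Shift A → ℂ} {a : ℝ} (ha : 0 ≤ a)
    (hG : ∀ y, wordOf n y = w → ‖G y‖ ≤ a) (x : Shift A) : ‖branch w G x‖ ≤ a := by
  by_cases h : ∃ y : Shift A, shift^[n] y = x ∧ wordOf n y = w
  · obtain ⟨y, hx, hw⟩ := h
    rw [branch_eq _ hx hw]
    exact hG y hw
  · rwa [branch_eq_zero _ h, norm_zero]

/-- Points that agree on `m` letters have preimages under an inverse branch of `σⁿ` that agree on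
`n + m` letters. -/
theorem exists_preimage_of_agree {m : ℕ} (hm : 1 ≤ m) {x x' y : Shift A}
    (hxx' : ∀ i < m, x.1 i = x'.1 i) (hx : shift^[n] y = x) :
    ∃ y' : Shift A, shift^[n] y' = x' ∧ ∀ i < n + m, y.1 i = y'.1 i := by
  have hyx : ∀ k, y.1 (n + k) = x.1 k := fun k => by rw [← hx, shift_iterate_apply]
  refine ⟨glue y n x' ((hyx 0).trans (hxx' 0 hm)), shift_iterate_glue _ _ _ _, fun i hi => ?_⟩
  rcases le_or_gt n i with h | h
  · obtain ⟨k, rfl⟩ := Nat.exists_eq_add_of_le h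
    rw [← shift_iterate_apply n (glue _ _ _ _), shift_iterate_glue, hyx]
    exact hxx' k (by omega)
  · exact (glue_apply_of_le _ _ _ _ h.le).symm

theorem norm_branch_sub_le {w : words A n} {G : Shift A → ℂ} {b : ℝ} (hb : 0 ≤ b) {m : ℕ}
    (hm : 1 ≤ m)
    (hG : ∀ y y' : Shift A, wordOf n y = w → wordOf n y' = w → (∀ i < n + m, y.1 i = y'.1 i) →
      ‖G y - G y'‖ ≤ b) {x x' : Shift A} (hxx' : ∀ i < m, x.1 i = x'.1 i) :
    ‖branch w G x - branch w G x'‖ ≤ b := by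
  by_cases h : ∃ y : Shift A, shift^[n] y = x ∧ wordOf n y = w
  · obtain ⟨y, hx, hw⟩ := h
    obtain ⟨y', hx', hyy'⟩ := exists_preimage_of_agree hm hxx' hx
    have hw' : wordOf n y' = w := by
      rw [← hw, wordOf_eq_wordOf_iff]
      exact fun i hi => (hyy' i (by omega)).symm
    rw [branch_eq _ hx hw, branch_eq _ hx' hw']
    exact hG y y' hw hw' hyy'
  · have h' : ¬ ∃ y : Shift A, shift^[n] y = x' ∧ wordOf n y = w := by
      rintro ⟨y, hx, hw⟩
      obtain ⟨y', hx', hyy'⟩ := exists_preimage_of_agree hm (fun i hi => (hxx' i hi).symm) hx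
      refine h ⟨y', hx', ?_⟩
      rw [← hw, wordOf_eq_wordOf_iff]
      exact fun i hi => (hyy' i (by omega)).symm
    rwa [branch_eq_zero _ h, branch_eq_zero _ h', sub_zero, norm_zero]

theorem hasSum_branch {G : Shift A → ℂ} {x : Shift A} {s : ℂ}
    (h : HasSum (fun y : {y : Shift A // shift^[n] y = x} => G y.1) s) :
    HasSum (fun w : words A n => branch w G x) s := by
  have hinj : Function.Injective
      fun y : {y : Shift A // shift^[n] y = x} => wordOf n y.1 := fun y y' h =>
    Subtype.ext (eq_of_shift_iterate_eq (y.2.trans y'.2.symm) (wordOf_eq_wordOf_iff.1 h))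
  refine (hinj.hasSum_iff fun w hw => branch_eq_zero G ?_).1 ?_
  · rintro ⟨y, hx, rfl⟩
    exact hw ⟨⟨y, hx⟩, rfl⟩
  · have : (fun w : words A n => branch w G x) ∘
        (fun y : {y : Shift A // shift^[n] y = x} => wordOf n y.1) = fun y => G y.1 :=
      funext fun y => branch_eq G y.2 rfl
    rwa [this]

end Branches

/-! ### Compact perturbations and peripheral eigenvalues -/

section Spectral

/-- No diagonalizability is needed: peel off the roots of `p` one at a time until the remaining
factor no longer kills `g`. -/
theorem exists_eigenvector_of_aeval_eq_zero {E : Type*} [AddCommGroup E] [Module ℂ E]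
    (T : Module.End ℂ E) {p : Polynomial ℂ} (hp : p ≠ 0) {g : E} (hg : g ≠ 0)
    (hpg : Polynomial.aeval T p g = 0) : ∃ μ h, p.IsRoot μ ∧ h ≠ 0 ∧ T h = μ • h := by
  induction hd : p.natDegree generalizing p with
  | zero =>
    rw [Polynomial.natDegree_eq_zero] at hd
    obtain ⟨c, rfl⟩ := hd
    have hc : c ≠ 0 := fun h => hp (by rw [h, map_zero])
    rw [Polynomial.aeval_C, Module.algebraMap_end_apply, smul_eq_zero] at hpg
    exact absurd hpg (by simp [hc, hg])
  | succ d ih =>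
    obtain ⟨r, hr⟩ := IsAlgClosed.exists_root p (by
      rw [Polynomial.degree_eq_natDegree hp, hd]
      exact_mod_cast Nat.succ_ne_zero d)
    obtain ⟨q, rfl⟩ := Polynomial.dvd_iff_isRoot.2 hr
    have hq : q ≠ 0 := right_ne_zero_of_mul hp
    by_cases hqg : Polynomial.aeval T q g = 0
    · obtain ⟨μ, h, hμ, hh⟩ := ih hq hqg (by
        rw [Polynomial.natDegree_mul (Polynomial.X_sub_C_ne_zero r) hq,
          Polynomial.natDegree_X_sub_C] at hd
        omega)
      exact ⟨μ, h, hμ.dvd (Dvd.intro_left _ rfl), hh⟩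
    · refine ⟨r, _, hr, hqg, ?_⟩
      rw [map_mul, Module.End.mul_apply, map_sub, Polynomial.aeval_X, Polynomial.aeval_C,
        LinearMap.sub_apply, Module.algebraMap_end_apply, sub_eq_zero] at hpg
      exact hpg

variable {E : Type*} [NormedAddCommGroup E] [NormedSpace ℂ E] [CompleteSpace E]

/-- If a power `Tⁿ` is within distance `< |z|ⁿ` of a compact operator, then a spectral value `z`
of `T` gives rise to an eigenvalue of `T` of the same modulus. -/
theorem exists_eigenvector_of_mem_spectrum (T K : E →L[ℂ] E) (hK : IsCompactOperator K) {n : ℕ}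
    (hn : n ≠ 0) {z : ℂ} (hz : z ∈ spectrum ℂ T) (hTK : ‖T ^ n - K‖ < ‖z‖ ^ n) :
    ∃ (μ : ℂ) (g : E), ‖μ‖ = ‖z‖ ∧ g ≠ 0 ∧ T g = μ • g := by
  have : Nontrivial E := by
    by_contra h
    rw [not_nontrivial_iff_subsingleton] at h
    exact hz (isUnit_of_subsingleton _)
  have hz0 : z ^ n ≠ 0 := by
    rw [← norm_pos_iff, norm_pow]
    exact (norm_nonneg _).trans_lt hTK
  have hpow : z ^ n ∈ spectrum ℂ (T ^ n) := spectrum.pow_mem_pow T n hz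
  obtain ⟨U, hU⟩ : IsUnit (algebraMap ℂ (E →L[ℂ] E) (z ^ n) - (T ^ n - K)) :=
    spectrum.mem_resolventSet_of_norm_lt (by rwa [norm_pow])
  set V : E →L[ℂ] E := ↑U⁻¹ with hV
  have hUV : (U : E →L[ℂ] E) * V = 1 := U.mul_inv
  have hVK : IsCompactOperator (V * K) := hK.clm_comp V
  -- `zⁿ - Tⁿ` is a unit times a compact perturbation of the identity
  have hfac : algebraMap ℂ (E →L[ℂ] E) (z ^ n) - T ^ n = U * (1 - V * K) := by
    rw [mul_sub, ← mul_assoc, hUV, hU, mul_one, one_mul, sub_sub, sub_add_cancel]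
  have hev : Module.End.HasEigenvalue ((V * K : E →L[ℂ] E) : Module.End ℂ E) 1 := by
    refine (hVK.hasEigenvalue_or_mem_resolventSet one_ne_zero).resolve_right fun h => hpow ?_
    show IsUnit _
    rw [hfac]
    refine U.isUnit.mul ?_
    simpa [spectrum.mem_resolventSet_iff] using h
  obtain ⟨g, hg⟩ := hev.exists_hasEigenvector
  have hg1 : (V * K) g = g := by simpa using hg.apply_eq_smul
  have hTg : (T ^ n) g = z ^ n • g := by
    have h : (algebraMap ℂ (E →L[ℂ] E) (z ^ n) - T ^ n) g = 0 := by
      rw [hfac, mul_apply_eq_comp, _root_.sub_apply, hg1,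
        one_apply_eq_self, sub_self, map_zero]
    rw [_root_.sub_apply, sub_eq_zero] at h
    rw [← h, Algebra.algebraMap_eq_smul_one]
    simp
  -- `g` is annihilated by the polynomial `Xⁿ - zⁿ` in `T`, all of whose roots have modulus `|z|`
  obtain ⟨μ, h, hμ, hh, hTh⟩ := exists_eigenvector_of_aeval_eq_zero (T : Module.End ℂ E)
    (p := Polynomial.X ^ n - Polynomial.C (z ^ n))
    (Polynomial.X_pow_sub_C_ne_zero (Nat.pos_of_ne_zero hn) _) hg.2 (by
      rw [map_sub, map_pow, Polynomial.aeval_X, Polynomial.aeval_C, LinearMap.sub_apply,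
        Module.algebraMap_end_apply, sub_eq_zero, ← hTg, Module.End.pow_apply,
        FunLike.coe_pow_eq_iterate]
      rfl)
  refine ⟨μ, h, ?_, hh, hTh⟩
  have : μ ^ n = z ^ n := by simpa [sub_eq_zero] using hμ
  refine (pow_left_inj₀ (norm_nonneg _) (norm_nonneg _) hn).1 ?_
  rw [← norm_pow, ← norm_pow, this]

end Spectral

/-! ### Approximation of the iterates by compact operators -/

section Compact

variable {n : ℕ}

/-- The real number `exp (sup_{[w]} S_n u)`, for a word `w` of length `n`. -/
def wordWeight (u : Shift A → ℝ) (w : words A n) : ℝ :=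
  (EReal.exp (⨆ x ∈ cylinder A w.1, ((birkhoffSum shift u n x : ℝ) : EReal))).toReal

theorem wordWeight_nonneg (u : Shift A → ℝ) (w : words A n) : 0 ≤ wordWeight u w :=
  ENNReal.toReal_nonneg

theorem hasSum_wordWeight {u : Shift A → ℝ} (h : partitionFunction u n ≠ ⊤) :
    HasSum (wordWeight u : words A n → ℝ) (partitionFunction u n).toReal := by
  rw [partitionFunction, ENNReal.tsum_toReal_eq (ENNReal.ne_top_of_tsum_ne_top h)]
  exact ENNReal.hasSum_toReal h

theorem exp_birkhoffSum_le_wordWeight {u : Shift A → ℝ} (h : partitionFunction u n ≠ ⊤)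
    {w : words A n} {y : Shift A} (hy : wordOf n y = w) :
    Real.exp (birkhoffSum shift u n y) ≤ wordWeight u w := by
  subst hy
  have := ENNReal.toReal_mono (ENNReal.ne_top_of_tsum_ne_top h (wordOf n y))
    (ofReal_exp_birkhoffSum_le u n y)
  rwa [ENNReal.toReal_ofReal (Real.exp_pos _).le] at this

variable {θ : Set.Ioo (0 : ℝ) 1} {f : Shift A → ℂ}

theorem norm_exp_birkhoffSum_le_wordWeight (hZ : partitionFunction (fun x => (f x).re) n ≠ ⊤)
    {w : words A n} {y : Shift A} (hy : wordOf n y = w) :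
    ‖Complex.exp (birkhoffSum shift f n y)‖ ≤ wordWeight (fun x => (f x).re) w := by
  rw [norm_exp_birkhoffSum]
  exact exp_birkhoffSum_le_wordWeight hZ hy

theorem norm_exp_birkhoffSum_sub_le (hf : holderSeminorm θ f < ⊤)
    (hZ : partitionFunction (fun x => (f x).re) n ≠ ⊤) {w : words A n} {m : ℕ} {y y' : Shift A}
    (hy : wordOf n y = w) (hy' : wordOf n y' = w) (h : ∀ i < n + m, y.1 i = y'.1 i) :
    ‖Complex.exp (birkhoffSum shift f n y) - Complex.exp (birkhoffSum shift f n y')‖ ≤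
      wordWeight (fun x => (f x).re) w * distortion θ f * (θ : ℝ) ^ m := by
  rw [mul_assoc]
  refine (norm_exp_sub_exp_le (c := wordWeight (fun x => (f x).re) w) ?_ ?_).trans
    (mul_le_mul_of_nonneg_left (norm_birkhoffSum_sub_le hf n m h) (wordWeight_nonneg _ _))
  · rw [re_birkhoffSum]
    exact exp_birkhoffSum_le_wordWeight hZ hy
  · rw [re_birkhoffSum]
    exact exp_birkhoffSum_le_wordWeight hZ hy'

variable [TopologicalSpace ι] [DiscreteTopology ι]

/-- The contribution `x ↦ exp (S_n f (w x))` of an inverse branch, as a Hölder function. -/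
def branchWeight (hf : holderSeminorm θ f < ⊤)
    (hZ : partitionFunction (fun x => (f x).re) n ≠ ⊤) (w : words A n) : HolderSpace A θ :=
  HolderSpace.ofBounds (branch w fun y => Complex.exp (birkhoffSum shift f n y))
    (wordWeight (fun x => (f x).re) w)
    (mul_nonneg (wordWeight_nonneg (fun x => (f x).re) w) (distortion_nonneg θ f))
    (norm_branch_le (wordWeight_nonneg _ _) fun _ hy => norm_exp_birkhoffSum_le_wordWeight hZ hy)
    (fun m hm _ _ hxy => norm_branch_sub_le
      (mul_nonneg (mul_nonneg (wordWeight_nonneg _ _) (distortion_nonneg θ f))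
        (pow_nonneg θ.2.1.le m)) hm
      (fun _ _ hy hy' h => norm_exp_birkhoffSum_sub_le hf hZ hy hy' h) hxy)

theorem norm_branchWeight_le (hf : holderSeminorm θ f < ⊤)
    (hZ : partitionFunction (fun x => (f x).re) n ≠ ⊤) (w : words A n) :
    ‖branchWeight hf hZ w‖ ≤ wordWeight (fun x => (f x).re) w * (1 + distortion θ f) := by
  refine (HolderSpace.norm_le_of_forall (wordWeight_nonneg (fun x => (f x).re) w)
    (mul_nonneg (wordWeight_nonneg (fun x => (f x).re) w) (distortion_nonneg θ f)) ?_ ?_).trans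
    (le_of_eq (by ring))
  · exact norm_branch_le (wordWeight_nonneg _ _)
      fun _ hy => norm_exp_birkhoffSum_le_wordWeight hZ hy
  · exact fun m hm _ _ hxy => norm_branch_sub_le
      (mul_nonneg (mul_nonneg (wordWeight_nonneg _ _) (distortion_nonneg θ f))
        (pow_nonneg θ.2.1.le m)) hm
      (fun _ _ hy hy' h => norm_exp_birkhoffSum_sub_le hf hZ hy hy' h) hxy

/-- The rank one operator `g ↦ g(x_w) exp (S_n f (w ·))`, where `x_w` is the base point of `[w]`. -/
def branchOperator (hf : holderSeminorm θ f < ⊤)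
    (hZ : partitionFunction (fun x => (f x).re) n ≠ ⊤) (w : words A n) :
    HolderSpace A θ →L[ℂ] HolderSpace A θ :=
  (HolderSpace.evalCLM θ (basePoint w)).smulRight (branchWeight hf hZ w)

theorem isCompactOperator_branchOperator (hf : holderSeminorm θ f < ⊤)
    (hZ : partitionFunction (fun x => (f x).re) n ≠ ⊤) (w : words A n) :
    IsCompactOperator (branchOperator hf hZ w) :=
  IsCompactOperator.clm_comp (f := HolderSpace.evalCLM (A := A) θ (basePoint w))
    (isCompactOperator_of_locallyCompactSpace_dom _)
    (ContinuousLinearMap.toSpanSingleton ℂ (branchWeight hf hZ w))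

theorem summable_branchOperator (hf : holderSeminorm θ f < ⊤)
    (hZ : partitionFunction (fun x => (f x).re) n ≠ ⊤) : Summable (branchOperator hf hZ) := by
  refine Summable.of_norm_bounded
    ((hasSum_wordWeight hZ).summable.mul_right (1 + distortion θ f)) fun w => ?_
  rw [branchOperator, ContinuousLinearMap.norm_smulRight_apply]
  calc _ ≤ 1 * ‖branchWeight hf hZ w‖ := by
        gcongr
        exact HolderSpace.norm_evalCLM_le _
    _ ≤ _ := by
        rw [one_mul]
        exact norm_branchWeight_le hf hZ w

/-- The compact part of the `n`-th iterate of the Perron-Frobenius operator: `g` is replaced by a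
function that is constant on the cylinders of length `n`. -/
def compactPart (hf : holderSeminorm θ f < ⊤)
    (hZ : partitionFunction (fun x => (f x).re) n ≠ ⊤) :
    HolderSpace A θ →L[ℂ] HolderSpace A θ :=
  ∑' w : words A n, branchOperator hf hZ w

theorem isCompactOperator_compactPart (hf : holderSeminorm θ f < ⊤)
    (hZ : partitionFunction (fun x => (f x).re) n ≠ ⊤) :
    IsCompactOperator (compactPart hf hZ) := by
  refine isCompactOperator_of_tendsto (summable_branchOperator hf hZ).hasSum
    (Eventually.of_forall fun s => ?_)
  exact (compactOperator (RingHom.id ℂ) (HolderSpace A θ) (HolderSpace A θ)).sum_mem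
    fun w _ => isCompactOperator_branchOperator hf hZ w

theorem hasSum_compactPart_apply (hf : holderSeminorm θ f < ⊤)
    (hZ : partitionFunction (fun x => (f x).re) n ≠ ⊤) (g : HolderSpace A θ) (x : Shift A) :
    HasSum (fun w : words A n => g (basePoint w) *
      branch w (fun y => Complex.exp (birkhoffSum shift f n y)) x) (compactPart hf hZ g x) :=
  (summable_branchOperator hf hZ).hasSum.mapL
    ((HolderSpace.evalCLM θ x).comp (ContinuousLinearMap.apply ℂ (HolderSpace A θ) g))

theorem hasSum_pow_sub_compactPart (hf : IsHolder θ f) (hu : IsSummable fun x => (f x).re)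
    (hZ : partitionFunction (fun x => (f x).re) n ≠ ⊤) (g : HolderSpace A θ) (x : Shift A) :
    HasSum (fun w : words A n => branch w
      (fun y => Complex.exp (birkhoffSum shift f n y) * (g y - g (basePoint w))) x)
      ((perronFrobenius hf hu ^ n - compactPart hf.2 hZ) g x) := by
  have h1 := hasSum_branch (G := fun y => Complex.exp (birkhoffSum shift f n y) * g y)
    (summable_exp_birkhoffSum_mul hu n x g.norm_apply_le).hasSum
  rw [← perronFrobenius_pow_apply hf hu n g x] at h1
  simp only [branch_sub_const_mul]
  exact h1.sub (hasSum_compactPart_apply hf.2 hZ g x)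

/-- The remainder of the compact approximation is small, because `g` oscillates by at most
`‖g‖ θⁿ` on the cylinders of length `n`. -/
theorem norm_pow_sub_compactPart_le (hf : IsHolder θ f) (hu : IsSummable fun x => (f x).re)
    (hn : 1 ≤ n) (hZ : partitionFunction (fun x => (f x).re) n ≠ ⊤) :
    ‖perronFrobenius hf hu ^ n - compactPart hf.2 hZ‖ ≤
      (partitionFunction (fun x => (f x).re) n).toReal * (2 + distortion θ f) * (θ : ℝ) ^ n := by
  have hθ : 0 < (θ : ℝ) := θ.2.1
  have hD := distortion_nonneg θ f
  have hZ0 : 0 ≤ (partitionFunction (fun x => (f x).re) n).toReal := ENNReal.toReal_nonneg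
  refine ContinuousLinearMap.opNorm_le_bound _ (by positivity) fun g => ?_
  have hosc : ∀ (w : words A n) (y : Shift A), wordOf n y = w →
      ‖g y - g (basePoint w)‖ ≤ ‖g‖ * (θ : ℝ) ^ n := fun w y hy =>
    g.norm_apply_sub_le hn (wordOf_eq_wordOf_iff.1 (hy.trans (wordOf_basePoint w).symm))
  have key1 : ∀ (w : words A n) (x : Shift A), ‖branch w (fun y =>
      Complex.exp (birkhoffSum shift f n y) * (g y - g (basePoint w))) x‖ ≤
      wordWeight (fun x => (f x).re) w * (‖g‖ * (θ : ℝ) ^ n) := by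
    intro w x
    have hw := wordWeight_nonneg (fun x => (f x).re) w
    refine norm_branch_le (by positivity) (fun y hy => ?_) x
    rw [norm_mul]
    gcongr
    · exact norm_exp_birkhoffSum_le_wordWeight hZ hy
    · exact hosc w y hy
  have key2 : ∀ (w : words A n) (m : ℕ), 1 ≤ m → ∀ x x' : Shift A, (∀ i < m, x.1 i = x'.1 i) →
      ‖branch w (fun y => Complex.exp (birkhoffSum shift f n y) * (g y - g (basePoint w))) x -
        branch w (fun y => Complex.exp (birkhoffSum shift f n y) * (g y - g (basePoint w))) x'‖ ≤
      wordWeight (fun x => (f x).re) w *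
        ((1 + distortion θ f) * ‖g‖ * (θ : ℝ) ^ n * (θ : ℝ) ^ m) := by
    intro w m hm x x' hxx'
    have hw := wordWeight_nonneg (fun x => (f x).re) w
    refine norm_branch_sub_le (by positivity) hm (fun y y' hy hy' hyy' => ?_) hxx'
    set c := g (basePoint w)
    have e1 := norm_exp_birkhoffSum_sub_le hf.2 hZ hy hy' hyy'
    have e2 := norm_exp_birkhoffSum_le_wordWeight hZ hy'
    have e3 := hosc w y hy
    have e4 := g.norm_apply_sub_le (by omega) hyy'
    calc ‖Complex.exp (birkhoffSum shift f n y) * (g y - c) -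
          Complex.exp (birkhoffSum shift f n y') * (g y' - c)‖
        = ‖(Complex.exp (birkhoffSum shift f n y) - Complex.exp (birkhoffSum shift f n y')) *
            (g y - c) + Complex.exp (birkhoffSum shift f n y') * (g y - g y')‖ := by
          congr 1; ring
      _ ≤ wordWeight (fun x => (f x).re) w * distortion θ f * (θ : ℝ) ^ m * (‖g‖ * (θ : ℝ) ^ n) +
          wordWeight (fun x => (f x).re) w * (‖g‖ * (θ : ℝ) ^ (n + m)) := by
          refine (norm_add_le _ _).trans ?_
          rw [norm_mul, norm_mul]
          gcongr
      _ = _ := by ring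
  have hs := hasSum_wordWeight hZ
  have hsum := fun x => hasSum_pow_sub_compactPart hf hu hZ g x
  refine (HolderSpace.norm_le_of_forall
    (a := (partitionFunction (fun x => (f x).re) n).toReal * (‖g‖ * (θ : ℝ) ^ n))
    (b := (partitionFunction (fun x => (f x).re) n).toReal *
      ((1 + distortion θ f) * ‖g‖ * (θ : ℝ) ^ n)) (by positivity) (by positivity)
    (fun x => ?_) (fun m hm x y hxy => ?_)).trans (le_of_eq (by ring))
  · rw [← (hsum x).tsum_eq]
    exact tsum_of_norm_bounded (hs.mul_right _) fun w => key1 w x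
  · rw [← ((hsum x).sub (hsum y)).tsum_eq, mul_assoc]
    exact tsum_of_norm_bounded (hs.mul_right _) fun w => key2 w m hm x y hxy

end Compact

/-! ### Subinvariant functions -/

section Subinvariant

variable {θ : Set.Ioo (0 : ℝ) 1} {u : Shift A → ℝ}

/-- At zero pressure, a bounded subinvariant function cannot grow on a cylinder: the gains would
accumulate along the iterates, since these return to every cylinder with positive frequency. -/
theorem not_add_indicator_le_preimageSum (hA : FinitelyIrreducible A)
    (hu : holderSeminorm θ u < ⊤) {c C : ℝ≥0∞} (hc : c ≠ 0) (hC : C ≠ ⊤)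
    (hcu : ∀ n x, c ≤ preimageSum u n (fun _ => 1) x)
    (huC : ∀ n x, preimageSum u n (fun _ => 1) x ≤ C) {φ : Shift A → ℝ≥0∞} {B : ℝ≥0∞} (hB : B ≠ ⊤)
    (hφB : ∀ x, φ x ≤ B) {n : ℕ} (hn : 1 ≤ n) (z : Shift A) {ε : ℝ≥0∞} (hε : ε ≠ 0) :
    ¬ (φ + fun x => ε * (cylinder A (wordOf n z).1).indicator 1 x) ≤ preimageSum u 1 φ := by
  intro hφ
  obtain ⟨K, hK⟩ := exists_le_sum_preimageSum_indicator hA hu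
  obtain ⟨d, hd, hdK⟩ := hK n hn z
  set χ : Shift A → ℝ≥0∞ := (cylinder A (wordOf n z).1).indicator 1
  have hiter : ∀ N x, φ x + ε * ∑ j ∈ Finset.range N, preimageSum u j χ x ≤
      preimageSum u N φ x := by
    intro N x
    induction N with
    | zero => simp [preimageSum_zero]
    | succ N ih =>
      rw [preimageSum_add, Finset.sum_range_succ, mul_add, ← add_assoc]
      refine le_trans ?_ (preimageSum_mono u N hφ x)
      rw [preimageSum_add_fun, Pi.add_apply, preimageSum_const_mul]
      gcongr
  have hbd : ε * ∑' j, preimageSum u j χ z ≤ B * C := by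
    rw [← ENNReal.tsum_mul_left]
    refine ENNReal.tsum_le_of_sum_range_le fun N => ?_
    rw [← Finset.mul_sum]
    exact le_add_self.trans ((hiter N z).trans ((preimageSum_le_const u N hφB z).trans
      (by gcongr; exact huC N z)))
  have hfin : ∑' j, preimageSum u j χ z ≠ ⊤ := by
    intro h
    rw [h, ENNReal.mul_top hε, top_le_iff] at hbd
    exact ENNReal.mul_ne_top hB hC hbd
  -- each `j` contributes at least `d * c`, and each iterate is counted at most once for each `k`
  have hdiv : (⊤ : ℝ≥0∞) ≤ ∑ k ∈ K, ∑' j, preimageSum u j χ z := by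
    calc (⊤ : ℝ≥0∞) = ∑' _ : ℕ, d * c :=
          (ENNReal.tsum_const_eq_top_of_ne_zero (mul_ne_zero hd hc)).symm
      _ ≤ ∑' j, ∑ k ∈ K, preimageSum u (j + (n + k)) χ z := by
          refine ENNReal.tsum_le_tsum fun j => ?_
          simp only [preimageSum_add u j]
          rw [← preimageSum_finset_sum u j K]
          refine le_trans ?_ (const_le_preimageSum u j hdK z)
          gcongr
          exact hcu j z
      _ = ∑ k ∈ K, ∑' j, preimageSum u (j + (n + k)) χ z :=
          Summable.tsum_finsetSum fun _ _ => ENNReal.summable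
      _ ≤ _ := Finset.sum_le_sum fun k _ => ENNReal.tsum_comp_le_tsum_of_injective
          (add_left_injective (n + k)) fun j => preimageSum u j χ z
  rw [Finset.sum_const, nsmul_eq_mul, top_le_iff] at hdiv
  exact ENNReal.mul_ne_top (ENNReal.natCast_ne_top _) hfin hdiv

/-- An invariant function that is positive on a cylinder is bounded away from zero. -/
theorem exists_le_of_preimageSum_eq (hA : FinitelyIrreducible A) (hu : holderSeminorm θ u < ⊤)
    {φ : Shift A → ℝ≥0∞} (hφ : preimageSum u 1 φ = φ) {n : ℕ} (hn : 1 ≤ n) (z : Shift A)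
    {ε : ℝ≥0∞} (hε : ε ≠ 0)
    (hφε : (fun x => ε * (cylinder A (wordOf n z).1).indicator 1 x) ≤ φ) :
    ∃ δ : ℝ≥0∞, δ ≠ 0 ∧ ∀ x, δ ≤ φ x := by
  obtain ⟨K, hK⟩ := exists_le_sum_preimageSum_indicator hA hu
  obtain ⟨d, hd, hdK⟩ := hK n hn z
  have hinv : ∀ m, preimageSum u m φ = φ := by
    intro m
    induction m with
    | zero => exact preimageSum_zero u φ
    | succ m ih => rw [preimageSum_add, hφ, ih]
  refine ⟨ε * d / K.card, by simp [hε, hd], fun x => ENNReal.div_le_of_le_mul ?_⟩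
  calc ε * d ≤ ε * ∑ k ∈ K, preimageSum u (n + k) ((cylinder A (wordOf n z).1).indicator 1) x := by
        gcongr
        exact hdK x
    _ ≤ ∑ k ∈ K, φ x := by
        rw [Finset.mul_sum]
        refine Finset.sum_le_sum fun k _ => ?_
        rw [← preimageSum_const_mul]
        exact (preimageSum_mono u (n + k) hφε x).trans_eq (congrFun (hinv (n + k)) x)
    _ = φ x * K.card := by rw [Finset.sum_const, nsmul_eq_mul, mul_comm]

theorem preimageSum_sub_const (u : Shift A → ℝ) (P : ℝ) (n : ℕ) (φ : Shift A → ℝ≥0∞)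
    (x : Shift A) : preimageSum (fun y => u y - P) n φ x =
      ENNReal.ofReal (Real.exp (-(n * P))) * preimageSum u n φ x := by
  rw [preimageSum, preimageSum, ← ENNReal.tsum_mul_left]
  refine tsum_congr fun y => ?_
  have : birkhoffSum shift (fun y => u y - P) n y.1 = -(n * P) + birkhoffSum shift u n y.1 := by
    rw [birkhoffSum, birkhoffSum, Finset.sum_sub_distrib]
    simp
    ring
  rw [this, Real.exp_add, ENNReal.ofReal_mul (Real.exp_pos _).le, mul_assoc]

theorem holderSeminorm_sub_const (u : Shift A → ℝ) (P : ℝ) :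
    holderSeminorm θ (fun y => u y - P) = holderSeminorm θ u := by
  simp [holderSeminorm, variation]

end Subinvariant

/-! ### Phases of peripheral eigenfunctions -/

section Phase

/-- Equality in the triangle inequality: all terms point in the direction of the sum. -/
theorem mul_norm_tsum_eq_norm_mul_tsum {κ : Type*} {t : κ → ℂ} (ht : Summable fun i => ‖t i‖)
    (h : ∑' i, ‖t i‖ ≤ ‖∑' i, t i‖) (i : κ) :
    t i * (‖∑' i, t i‖ : ℝ) = (‖t i‖ : ℝ) * ∑' i, t i := by
  set s := ∑' i, t i with hs
  have hst : Summable t := ht.of_norm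
  -- after rotation by `conj s` the sum is real, so every term has to equal its modulus
  have hre : HasSum (fun i => (starRingEnd ℂ s * t i).re) (‖s‖ ^ 2) := by
    have := Complex.hasSum_re (hst.hasSum.mul_left (starRingEnd ℂ s))
    rwa [← hs, Complex.conj_mul', ← Complex.ofReal_pow, Complex.ofReal_re] at this
  have hnn : ∀ i, 0 ≤ ‖s‖ * ‖t i‖ - (starRingEnd ℂ s * t i).re := fun i => by
    have := Complex.re_le_norm (starRingEnd ℂ s * t i)
    rw [norm_mul, RCLike.norm_conj] at this
    linarith
  have hsum := (ht.hasSum.mul_left ‖s‖).sub hre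
  have hzero : ‖s‖ * ‖t i‖ - (starRingEnd ℂ s * t i).re = 0 := by
    refine le_antisymm ?_ (hnn i)
    refine (le_hasSum hsum i fun j _ => hnn j).trans ?_
    nlinarith [norm_nonneg s]
  have hreal : starRingEnd ℂ s * t i = ((‖s‖ * ‖t i‖ : ℝ) : ℂ) := by
    have h1 : (starRingEnd ℂ s * t i).re = ‖starRingEnd ℂ s * t i‖ := by
      rw [norm_mul, RCLike.norm_conj]
      linarith
    have h2 := Complex.re_eq_norm.1 h1
    rw [Complex.eq_coe_norm_of_nonneg h2, norm_mul, RCLike.norm_conj]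
  rcases eq_or_ne s 0 with h0 | h0
  · have : ‖t i‖ ≤ 0 := by
      refine (ht.le_tsum i fun j _ => norm_nonneg _).trans (h.trans ?_)
      rw [h0, norm_zero]
    rw [norm_le_zero_iff.1 this]
    simp
  · have hs0 : ((‖s‖ : ℝ) : ℂ) ≠ 0 := by exact_mod_cast norm_ne_zero_iff.2 h0
    have h3 : s * (starRingEnd ℂ s * t i) = s * ((‖s‖ * ‖t i‖ : ℝ) : ℂ) := by rw [hreal]
    rw [← mul_assoc, Complex.mul_conj'] at h3
    refine mul_left_cancel₀ hs0 ?_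
    push_cast at h3 ⊢
    linear_combination h3

variable [TopologicalSpace ι] [DiscreteTopology ι] {θ : Set.Ioo (0 : ℝ) 1}

theorem isLocallyConstant_wordOf (n : ℕ) :
    IsLocallyConstant (wordOf n : Shift A → words A n) := by
  rw [IsLocallyConstant.iff_eventually_eq]
  intro x
  have hev : ∀ᶠ y : Shift A in 𝓝 x, ∀ i ∈ Finset.range n, y.1 i = x.1 i := by
    rw [Filter.eventually_all_finset]
    intro i _
    have hc : Continuous fun y : Shift A => y.1 i :=
      (continuous_apply i).comp continuous_subtype_val
    exact hc.continuousAt.eventually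
      (((isOpen_discrete ({x.1 i} : Set ι)).mem_nhds rfl : ({x.1 i} : Set ι) ∈ 𝓝 (x.1 i)))
  filter_upwards [hev] with y hy
  exact wordOf_eq_wordOf_iff.2 fun i hi => hy i (Finset.mem_range.2 hi)

namespace HolderSpace

/-- A Hölder function that is bounded away from zero has a continuous argument: the argument is
chosen freely at one point of each short cylinder and followed within the cylinder. -/
theorem exists_continuous_arg (g : HolderSpace A θ) {δ : ℝ} (hδ : 0 < δ)
    (hg : ∀ x, δ ≤ ‖g x‖) :
    ∃ ψ : C(Shift A, ℝ), ∀ x, g x = (‖g x‖ : ℝ) * Complex.exp (ψ x * Complex.I) := by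
  obtain ⟨n, -, hn⟩ := g.exists_norm_sub_lt hδ
  have hg0 : ∀ x, g x ≠ 0 := fun x => norm_pos_iff.1 (hδ.trans_le (hg x))
  set b : Shift A → Shift A := fun x => basePoint (wordOf n x) with hb
  have hbl : IsLocallyConstant b := (isLocallyConstant_wordOf n).comp basePoint
  have hslit : ∀ x, g x / g (b x) ∈ Complex.slitPlane := by
    intro x
    have h1 : ‖g x / g (b x) - 1‖ < 1 := by
      rw [div_sub_one (hg0 _), norm_div, div_lt_one (norm_pos_iff.2 (hg0 _))]
      exact (hn x (b x) fun i hi => (basePoint_wordOf_apply x hi).symm).trans_le (hg _)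
    have := Complex.mem_slitPlane_of_norm_lt_one h1
    rwa [add_sub_cancel] at this
  have hgb : Continuous fun x => g (b x) := (hbl.comp fun y => g y).continuous
  have hc : Continuous fun x => g x / g (b x) :=
    g.toBCF.continuous.div hgb fun x => hg0 _
  refine ⟨⟨fun x => Complex.arg (g (b x)) + Complex.arg (g x / g (b x)), ?_⟩, fun x => ?_⟩
  · refine ((hbl.comp fun y => Complex.arg (g y)).continuous).add ?_
    rw [continuous_iff_continuousAt]
    exact fun x => ContinuousAt.comp (f := fun x => g x / g (b x))
      (Complex.continuousAt_arg (hslit x)) hc.continuousAt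
  · have e1 := Complex.norm_mul_exp_arg_mul_I (g (b x))
    have e2 := Complex.norm_mul_exp_arg_mul_I (g x / g (b x))
    have e3 : ‖g x‖ = ‖g (b x)‖ * ‖g x / g (b x)‖ := by
      rw [norm_div, mul_div_cancel₀ _ (norm_ne_zero_iff.2 (hg0 _))]
    rw [e3]
    simp only [ContinuousMap.coe_mk]
    push_cast
    rw [add_mul, Complex.exp_add]
    calc g x = g (b x) * (g x / g (b x)) := (mul_div_cancel₀ _ (hg0 _)).symm
      _ = (‖g (b x)‖ * Complex.exp (Complex.arg (g (b x)) * Complex.I)) *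
          (‖g x / g (b x)‖ * Complex.exp (Complex.arg (g x / g (b x)) * Complex.I)) := by
        rw [e1, e2]
      _ = _ := by ring

end HolderSpace

theorem exists_angle (z : ℂ) : ∃ a ∈ Set.Ico (0 : ℝ) (2 * Real.pi),
    z = (‖z‖ : ℝ) * Complex.exp (a * Complex.I) := by
  refine ⟨toIcoMod Real.two_pi_pos 0 (Complex.arg z), ?_, ?_⟩
  · simpa using toIcoMod_mem_Ico Real.two_pi_pos 0 (Complex.arg z)
  · conv_lhs => rw [← Complex.norm_mul_exp_arg_mul_I z]
    congr 1
    rw [Complex.exp_eq_exp_iff_exists_int]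
    refine ⟨toIcoDiv Real.two_pi_pos 0 (Complex.arg z), ?_⟩
    have := toIcoMod_add_toIcoDiv_zsmul Real.two_pi_pos 0 (Complex.arg z)
    rw [zsmul_eq_mul] at this
    conv_lhs => rw [← this]
    push_cast
    ring

/-- If the phases of an eigenfunction align along all branches, then its argument is a transfer
function that exhibits `f` as an `a`-function. -/
theorem exists_isAFunction_of_aligned {f : Shift A → ℂ} {g : HolderSpace A θ} {z : ℂ} (hz : z ≠ 0)
    {δ : ℝ} (hδ : 0 < δ) (hg : ∀ x, δ ≤ ‖g x‖)
    (h : ∀ y, Complex.exp (f y) * g y * (‖z * g (shift y)‖ : ℝ) =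
      (‖Complex.exp (f y) * g y‖ : ℝ) * (z * g (shift y))) :
    ∃ a ∈ Set.Ico (0 : ℝ) (2 * Real.pi), IsAFunction f a := by
  obtain ⟨ψ, hψ⟩ := g.exists_continuous_arg hδ hg
  obtain ⟨a, ha, hza⟩ := exists_angle z
  refine ⟨a, ha, -ψ, fun y => ?_⟩
  have hn : ∀ x, ((‖g x‖ : ℝ) : ℂ) ≠ 0 := fun x => by
    exact_mod_cast (hδ.trans_le (hg x)).ne'
  have hnz : ((‖z‖ : ℝ) : ℂ) ≠ 0 := by exact_mod_cast norm_ne_zero_iff.2 hz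
  have hexp : Complex.exp (f y) =
      (Real.exp (f y).re : ℝ) * Complex.exp ((f y).im * Complex.I) := by
    rw [Complex.ofReal_exp, ← Complex.exp_add, Complex.re_add_im]
  have hy := h y
  rw [norm_mul, norm_mul, Complex.norm_exp, hexp] at hy
  have key : Complex.exp ((f y).im * Complex.I) * Complex.exp (ψ y * Complex.I) =
      Complex.exp (a * Complex.I) * Complex.exp (ψ (shift y) * Complex.I) := by
    have hc : ((Real.exp (f y).re : ℝ) : ℂ) * (‖g y‖ : ℝ) * (‖z‖ : ℝ) * (‖g (shift y)‖ : ℝ) ≠ 0 :=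
      mul_ne_zero (mul_ne_zero (mul_ne_zero
        (by exact_mod_cast (Real.exp_pos _).ne') (hn y)) hnz) (hn _)
    refine mul_left_cancel₀ hc ?_
    have h1 := hψ y
    have h2 := hψ (shift y)
    push_cast at hy h1 h2 hza ⊢
    set E₁ := Complex.exp ((f y).im * Complex.I)
    set E₂ := Complex.exp (ψ y * Complex.I)
    set E₃ := Complex.exp (a * Complex.I)
    set E₄ := Complex.exp (ψ (shift y) * Complex.I)
    linear_combination hy - Complex.exp (f y).re * E₁ * ‖z‖ * ‖g (shift y)‖ * h1 +
      Complex.exp (f y).re * ‖g y‖ * z * h2 +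
      Complex.exp (f y).re * ‖g y‖ * ‖g (shift y)‖ * E₄ * hza
  rw [← Complex.exp_add, ← Complex.exp_add, Complex.exp_eq_exp_iff_exists_int] at key
  obtain ⟨k, hk⟩ := key
  refine ⟨k, ?_⟩
  have him := congrArg Complex.im hk
  simp at him
  simp
  linarith

end Phase

/-! ### Peripheral eigenvalues of regular functions -/

section Peripheral

variable {θ : Set.Ioo (0 : ℝ) 1} {f : Shift A → ℂ}

theorem holderSeminorm_re_lt_top (hf : holderSeminorm θ f < ⊤) :
    holderSeminorm θ (fun x => (f x).re) < ⊤ :=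
  (holderSeminorm_toReal_le ENNReal.toReal_nonneg fun n hn x y hxy => by
    rw [← Complex.sub_re, Real.norm_eq_abs]
    exact (Complex.abs_re_le_norm _).trans (norm_sub_le_of_holder hf hn hxy)).1

variable [TopologicalSpace ι]

theorem isHolder_ofReal_re (hf : IsHolder θ f) : IsHolder θ fun x => ((f x).re : ℂ) := by
  refine ⟨Complex.continuous_ofReal.comp (Complex.continuous_re.comp hf.1),
    (holderSeminorm_toReal_le
      (ENNReal.toReal_nonneg (a := holderSeminorm θ f)) fun n hn x y hxy => ?_).1⟩
  rw [← Complex.ofReal_sub, Complex.norm_real, ← Complex.sub_re, Real.norm_eq_abs]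
  exact (Complex.abs_re_le_norm _).trans (norm_sub_le_of_holder hf.2 hn hxy)

/-- The Perron-Frobenius operator of `Re f` at `|g|`, as a real function. -/
def realTransferAbs (f : Shift A → ℂ) (g : HolderSpace A θ) (x : Shift A) : ℝ :=
  ∑' y : {y : Shift A // shift^[1] y = x}, ‖Complex.exp (f y.1) * g y.1‖

theorem summable_norm_exp_mul (hu : IsSummable fun x => (f x).re) (g : HolderSpace A θ)
    (x : Shift A) : Summable fun y : {y : Shift A // shift^[1] y = x} =>
      ‖Complex.exp (f y.1) * g y.1‖ := by
  have := (summable_exp_birkhoffSum_mul hu 1 x g.norm_apply_le).norm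
  simpa only [birkhoffSum_one] using this

theorem ofReal_realTransferAbs (hu : IsSummable fun x => (f x).re) (g : HolderSpace A θ)
    (x : Shift A) : ENNReal.ofReal (realTransferAbs f g x) =
      preimageSum (fun x => (f x).re) 1 (fun y => ENNReal.ofReal ‖g y‖) x := by
  rw [realTransferAbs, ENNReal.ofReal_tsum_of_nonneg (fun _ => norm_nonneg _)
    (summable_norm_exp_mul hu g x), preimageSum]
  refine tsum_congr fun y => ?_
  rw [norm_mul, Complex.norm_exp, ENNReal.ofReal_mul (Real.exp_pos _).le, birkhoffSum_one]

variable [DiscreteTopology ι]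

/-- The absolute value of a Hölder function. -/
def HolderSpace.abs (g : HolderSpace A θ) : HolderSpace A θ :=
  HolderSpace.ofBounds (fun x => ((‖g x‖ : ℝ) : ℂ)) ‖g‖ (norm_nonneg g)
    (fun x => by
      rw [Complex.norm_real, norm_norm]
      exact g.norm_apply_le x)
    (fun n hn x y hxy => by
      rw [← Complex.ofReal_sub, Complex.norm_real, Real.norm_eq_abs]
      exact (abs_norm_sub_norm_le _ _).trans (g.norm_apply_sub_le hn hxy))

/-- The function `L_{Re f} |g| - c |g|` is Hölder. -/
theorem exists_eq_realTransferAbs_sub (hf : IsHolder θ f) (hu : IsSummable fun x => (f x).re)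
    (g : HolderSpace A θ) (c : ℝ) :
    ∃ h : HolderSpace A θ, ∀ x, h x = ((realTransferAbs f g x - c * ‖g x‖ : ℝ) : ℂ) := by
  have hu' : IsSummable fun x : Shift A => (((f x).re : ℂ)).re := by
    simpa only [Complex.ofReal_re] using hu
  refine ⟨transferHolder (isHolder_ofReal_re hf) hu' g.abs - (c : ℂ) • g.abs, fun x => ?_⟩
  rw [HolderSpace.sub_apply, HolderSpace.smul_apply, transferHolder_apply, transfer_eq_tsum,
    realTransferAbs, Complex.ofReal_sub, Complex.ofReal_mul, Complex.ofReal_tsum]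
  congr 1
  refine tsum_congr fun y => ?_
  rw [norm_mul, Complex.norm_exp, Complex.ofReal_mul, Complex.ofReal_exp]
  rfl

/-- An eigenfunction of the Perron-Frobenius operator with eigenvalue of modulus at least `exp P`
exhibits `f` as an `a`-function. Its modulus is subinvariant, hence invariant, hence bounded away
from zero, and its phases align. -/
theorem exists_isAFunction_of_eigenvector (hA : FinitelyIrreducible A) (hf : IsHolder θ f)
    (hu : IsSummable fun x => (f x).re) {P C : ℝ} (hC : 0 < C)
    (hupper : ∀ n x, preimageSum (fun x => (f x).re) n (fun _ => 1) x ≤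
      ENNReal.ofReal (C * Real.exp (n * P)))
    (hlower : ∀ (n : ℕ) x, ENNReal.ofReal (C⁻¹ * Real.exp (n * P)) ≤
      preimageSum (fun x => (f x).re) n (fun _ => 1) x)
    {z : ℂ} {g : HolderSpace A θ} (hz : Real.exp P ≤ ‖z‖) (hg : g ≠ 0)
    (hgz : perronFrobenius hf hu g = z • g) :
    ∃ a ∈ Set.Ico (0 : ℝ) (2 * Real.pi), IsAFunction f a := by
  set u : Shift A → ℝ := fun x => (f x).re with hu_def
  -- `v` has zero pressure
  set v : Shift A → ℝ := fun x => u x - P with hv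
  set φ : Shift A → ℝ≥0∞ := fun x => ENNReal.ofReal ‖g x‖ with hφ
  have hvH : holderSeminorm θ v < ⊤ := by
    rw [hv, holderSeminorm_sub_const]
    exact holderSeminorm_re_lt_top hf.2
  have hvu : ∀ n x, preimageSum v n (fun _ => 1) x ≤ ENNReal.ofReal C := by
    intro n x
    rw [hv, preimageSum_sub_const]
    calc _ ≤ ENNReal.ofReal (Real.exp (-(n * P))) * ENNReal.ofReal (C * Real.exp (n * P)) := by
          gcongr
          exact hupper n x
      _ = ENNReal.ofReal C := by
          rw [← ENNReal.ofReal_mul (Real.exp_pos _).le, Real.exp_neg]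
          congr 1
          field_simp
  have hvl : ∀ n x, ENNReal.ofReal C⁻¹ ≤ preimageSum v n (fun _ => 1) x := by
    intro n x
    rw [hv, preimageSum_sub_const]
    calc ENNReal.ofReal C⁻¹ =
          ENNReal.ofReal (Real.exp (-(n * P))) * ENNReal.ofReal (C⁻¹ * Real.exp (n * P)) := by
          rw [← ENNReal.ofReal_mul (Real.exp_pos _).le, Real.exp_neg]
          congr 1
          field_simp
      _ ≤ _ := by
          gcongr
          exact hlower n x
  have hφ1 : ∀ x, preimageSum v 1 φ x =
      ENNReal.ofReal (Real.exp (-P) * realTransferAbs f g x) := by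
    intro x
    rw [hv, preimageSum_sub_const, ENNReal.ofReal_mul (Real.exp_pos _).le,
      ofReal_realTransferAbs hu]
    simp only [Nat.cast_one, one_mul, hφ, hu_def]
  have hgz' : ∀ x, ∑' y : {y : Shift A // shift^[1] y = x}, Complex.exp (f y.1) * g y.1 =
      z * g x := by
    intro x
    rw [← transfer_eq_tsum, ← perronFrobenius_apply hf hu, hgz]
    rfl
  have hle : ∀ x, ‖z‖ * ‖g x‖ ≤ realTransferAbs f g x := by
    intro x
    rw [← norm_mul, ← hgz' x]
    exact norm_tsum_le_tsum_norm (summable_norm_exp_mul hu g x)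
  have hle' : ∀ x, Real.exp P * ‖g x‖ ≤ realTransferAbs f g x := fun x =>
    (mul_le_mul_of_nonneg_right hz (norm_nonneg _)).trans (hle x)
  -- the modulus of `g` is invariant
  have heq : ∀ x, realTransferAbs f g x = Real.exp P * ‖g x‖ := by
    by_contra! hne
    obtain ⟨x₀, hx₀⟩ := hne
    obtain ⟨h, hh⟩ := exists_eq_realTransferAbs_sub hf hu g (Real.exp P)
    set d := realTransferAbs f g x₀ - Real.exp P * ‖g x₀‖ with hd
    have hd0 : 0 < d := sub_pos.2 (lt_of_le_of_ne (hle' x₀) hx₀.symm)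
    obtain ⟨m, hm, hmd⟩ := h.exists_norm_sub_lt (half_pos hd0)
    refine not_add_indicator_le_preimageSum hA hvH
      (by simpa using hC) ENNReal.ofReal_ne_top hvl hvu (φ := φ) (B := ENNReal.ofReal ‖g‖)
      ENNReal.ofReal_ne_top (fun x => ENNReal.ofReal_le_ofReal (g.norm_apply_le x)) hm x₀
      (ε := ENNReal.ofReal (Real.exp (-P) * (d / 2)))
      (by simpa using mul_pos (Real.exp_pos _) (half_pos hd0)) (fun x => ?_)
    rw [hφ1, Pi.add_apply]
    have hmul : ∀ t, Real.exp (-P) * (Real.exp P * t) = t := fun t => by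
      rw [← mul_assoc, ← Real.exp_add]
      simp
    by_cases hx : x ∈ cylinder A (wordOf m x₀).1
    · rw [Set.indicator_of_mem hx, Pi.one_apply, mul_one, hφ,
        ← ENNReal.ofReal_add (norm_nonneg _) (by positivity)]
      refine ENNReal.ofReal_le_ofReal ?_
      have h1 := hmd x x₀ (mem_cylinder_wordOf.1 hx)
      rw [hh, hh, ← Complex.ofReal_sub, Complex.norm_real, Real.norm_eq_abs] at h1
      have h2 := (abs_lt.1 h1).1
      calc ‖g x‖ + Real.exp (-P) * (d / 2)
          = Real.exp (-P) * (Real.exp P * ‖g x‖ + d / 2) := by rw [mul_add, hmul]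
        _ ≤ _ := by
          gcongr
          linarith
    · rw [Set.indicator_of_notMem hx, mul_zero, add_zero, hφ]
      refine ENNReal.ofReal_le_ofReal ?_
      rw [← hmul ‖g x‖]
      gcongr
      exact hle' x
  have hinv : preimageSum v 1 φ = φ := by
    funext x
    rw [hφ1, heq, ← mul_assoc, ← Real.exp_add]
    simp [hφ]
  obtain ⟨x₁, hx₁⟩ : ∃ x, g x ≠ 0 := by
    by_contra! h0
    exact hg (HolderSpace.toBCF_injective (BoundedContinuousFunction.ext h0))
  have hx₁' : 0 < ‖g x₁‖ := norm_pos_iff.2 hx₁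
  have hzP : ‖z‖ = Real.exp P := by
    refine le_antisymm ?_ hz
    have := hle x₁
    rw [heq] at this
    exact le_of_mul_le_mul_right this hx₁'
  have hz0 : z ≠ 0 := norm_pos_iff.1 (by rw [hzP]; exact Real.exp_pos P)
  -- the modulus of `g` is bounded away from zero
  obtain ⟨δ, hδ, hgδ⟩ : ∃ δ : ℝ, 0 < δ ∧ ∀ x, δ ≤ ‖g x‖ := by
    obtain ⟨m, hm, hmd⟩ := g.exists_norm_sub_lt (half_pos hx₁')
    obtain ⟨δ, hδ, hδφ⟩ := exists_le_of_preimageSum_eq hA hvH hinv hm x₁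
      (ε := ENNReal.ofReal (‖g x₁‖ / 2)) (by simpa using hx₁) (fun x => by
        by_cases hx : x ∈ cylinder A (wordOf m x₁).1
        · simp only [Set.indicator_of_mem hx, Pi.one_apply, mul_one, hφ]
          refine ENNReal.ofReal_le_ofReal ?_
          have h1 := hmd x x₁ (mem_cylinder_wordOf.1 hx)
          have h2 := norm_sub_norm_le (g x₁) (g x)
          rw [norm_sub_rev] at h2
          linarith
        · simp [Set.indicator_of_notMem hx])
    have hδt : δ ≠ ⊤ := ne_top_of_le_ne_top ENNReal.ofReal_ne_top (hδφ x₁)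
    exact ⟨δ.toReal, ENNReal.toReal_pos hδ hδt, fun x =>
      ENNReal.toReal_le_of_le_ofReal (norm_nonneg _) (hδφ x)⟩
  refine exists_isAFunction_of_aligned hz0 hδ hgδ fun y => ?_
  have := mul_norm_tsum_eq_norm_mul_tsum (summable_norm_exp_mul hu g (shift y)) (by
    rw [hgz', norm_mul, hzP, ← heq]
    rfl) ⟨y, rfl⟩
  rwa [hgz'] at this

end Peripheral

end MarkovShift

end

open MarkovShift in
theorem mainTheorem1 {ι : Type*} [Countable ι] [TopologicalSpace ι] [DiscreteTopology ι]
    (A : ι → ι → Prop) (hA : MarkovShift.FinitelyIrreducible A)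
    (θ : Set.Ioo (0 : ℝ) 1) (f : MarkovShift.Shift A → ℂ)
    (hf : MarkovShift.IsHolder θ f)
    (hu : MarkovShift.IsSummable fun x => (f x).re)
    (hreg : MarkovShift.IsRegular f) :
    ∃ P : ℝ, MarkovShift.HasPressure (fun x => (f x).re) P ∧
      ∃ r : ℝ, 0 ≤ r ∧ r < Real.exp P ∧
        spectrum ℂ (MarkovShift.perronFrobenius hf hu) ⊆ Metric.closedBall (0 : ℂ) r := by
  -- over the empty shift space every function is an `a`-function
  have hne : Nonempty (Shift A) := by
    by_contra h
    rw [not_nonempty_iff] at h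
    exact hreg 0 ⟨le_rfl, Real.two_pi_pos⟩ ⟨0, fun x => h.elim x⟩
  have hθ : 0 < (θ : ℝ) := θ.2.1
  obtain ⟨P, C, hC, hP, hupper, hlower, hZ⟩ :=
    exists_hasPressure hA (holderSeminorm_re_lt_top hf.2) hu
  have hspec : ∀ z ∈ spectrum ℂ (perronFrobenius hf hu), ‖z‖ < Real.exp P := by
    intro z hz
    by_contra! hzP
    have hlim : Tendsto (fun n : ℕ => C * (2 + distortion θ f) * (θ : ℝ) ^ n) atTop (𝓝 0) := by
      simpa using (tendsto_pow_atTop_nhds_zero_of_lt_one hθ.le θ.2.2).const_mul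
        (C * (2 + distortion θ f))
    obtain ⟨n, hn, hn1⟩ :=
      ((hlim.eventually_lt_const one_pos).and (eventually_ge_atTop 1)).exists
    have hZt : partitionFunction (fun x => (f x).re) n ≠ ⊤ :=
      ne_top_of_le_ne_top ENNReal.ofReal_ne_top (hZ n hn1)
    have hD := distortion_nonneg θ f
    have hR : ‖perronFrobenius hf hu ^ n - compactPart hf.2 hZt‖ < ‖z‖ ^ n := by
      calc _ ≤ (partitionFunction (fun x => (f x).re) n).toReal * (2 + distortion θ f) *
            (θ : ℝ) ^ n := norm_pow_sub_compactPart_le hf hu hn1 hZt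
        _ ≤ C * Real.exp (n * P) * (2 + distortion θ f) * (θ : ℝ) ^ n := by
            gcongr
            exact ENNReal.toReal_le_of_le_ofReal (by positivity) (hZ n hn1)
        _ = C * (2 + distortion θ f) * (θ : ℝ) ^ n * Real.exp (n * P) := by ring
        _ < 1 * Real.exp (n * P) := by gcongr
        _ = Real.exp P ^ n := by rw [one_mul, Real.exp_nat_mul]
        _ ≤ ‖z‖ ^ n := by gcongr
    obtain ⟨μ, g, hμ, hg, hgμ⟩ := exists_eigenvector_of_mem_spectrum _ _
      (isCompactOperator_compactPart hf.2 hZt) (by omega) hz hR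
    obtain ⟨a, ha, hfa⟩ := exists_isAFunction_of_eigenvector hA hf hu hC hupper hlower
      (hzP.trans_eq hμ.symm) hg hgμ
    exact hreg a ha hfa
  refine ⟨P, hP, ?_⟩
  rcases (spectrum ℂ (perronFrobenius hf hu)).eq_empty_or_nonempty with h | h
  · exact ⟨0, le_rfl, Real.exp_pos P, by rw [h]; exact Set.empty_subset _⟩
  · obtain ⟨z, hz, hmax⟩ :=
      (spectrum.isCompact (𝕜 := ℂ) (perronFrobenius hf hu)).exists_isMaxOn h
        continuous_norm.continuousOn
    exact ⟨‖z‖, norm_nonneg z, hspec z hz, fun w hw => by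
      rw [mem_closedBall_zero_iff]
      exact hmax hw⟩
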